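/- Let $F$ be a distribution function on $\mathbb{R}$ with $F(0)=0$, put $\bar F=1-F$, and let $x^*=\sup\{x: F(x)<1\}\in(0,\infty]$ be its right endpoint. Let $d\ge 2$ be an integer and let $$\psi(x)=\mathfrak{W}_dF(x)=\int_{(x,\infty)}\Bigl(1-\frac{x}{t}\Bigr)^{d-1}dF(t),\qquad x\ge 0,$$ be the Williamson $d$-transform of $F$. On $(0,\infty)$, $\psi$ is $d-2$ times differentiable and $(-1)^{d-2}\psi^{(d-2)}$ is convex; $\psi^{(d-1)}$ denotes the right-continuous version of the density of $\psi^{(d-2)}$, i.e. its right derivative. The function $\psi$ is regarded as the survival function of a distribution on $[0,\infty)$ (so $\psi(x)=1$ for $x<0$). A distribution function $G$ is in $\mathrm{MDA}(\Lambda)$, the maximum domain of attraction of the Gumbel law $\Lambda(x)=\exp(-e^{-x})$, if there are $c_n>0$ and $b_n\in\mathbb{R}$ with $G(c_nx+b_n)^n\to\Lambda(x)$ for all $x\in\mathbb{R}$; $\psi\in\mathrm{MDA}(\Lambda)$ means $1-\psi\in\mathrm{MDA}(\Lambda)$. If $\bar G$ is the survival function of $G$ and $e$ is the right endpoint of $G$,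 then a function $a$ that is positive on $(-\infty,e)$ is called an auxiliary function of $\bar G$ if $a(x)/x\to 0$ as $x\uparrow e$ and $$\lim_{x\uparrow e}\frac{\bar G(x+a(x)t)}{\bar G(x)}=e^{-t}\qquad\text{for all }t\in\mathbb{R}.$$ Suppose that $F$ or $\psi^{(d-1)}$ is differentiable on $(0,\infty)$. Then both are differentiable on $(0,\infty)$. If, in addition, $F'$ is monotone (non-decreasing or non-increasing) on $(x_0,x^*)$ for some $x_0<x^*$, then $$F\in\mathrm{MDA}(\Lambda)\iff\psi\in\mathrm{MDA}(\Lambda),$$ and in this case each of the two functions $$a(x)=\frac{\int_x^{x^*}\bar F(t)\,dt}{\bar F(x)}\qquad\text{and}\qquad a(x)=\frac{\int_x^{x^*}\psi(t)\,dt}{\psi(x)}$$ is an auxiliary function of both $\bar F$ and $\psi$. -/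

import Mathlib

open Set Filter Topology MeasureTheory

noncomputable section

/-- The Williamson `d`-transform of the distribution function `F`,
`x ↦ ∫_{(x, ∞)} (1 - x / t) ^ (d - 1) dF(t)`, meant for `x ≥ 0`. At `x = 0` it is `1 - F 0`. -/
def williamson (d : ℕ) (F : StieltjesFunction ℝ) (x : ℝ) : ℝ :=
  ∫ t in Ioi x, (1 - x / t) ^ (d - 1) ∂F.measure

/-- The function `ψ^(d-1)` on `(0, ∞)` for `ψ` the Williamson `d`-transform of `F`. In general
`ψ^(d-2)` is only (up to sign) convex on `(0, ∞)`, and `ψ^(d-1)` denotes the right-continuous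
version of its density; for a convex function this is its right derivative. -/
def williamsonTopDeriv (d : ℕ) (F : StieltjesFunction ℝ) (x : ℝ) : ℝ :=
  derivWithin (iteratedDeriv (d - 2) (williamson d F)) (Ioi x) x

/-- The distribution function on `ℝ` of the law on `[0, ∞)` whose survival function is the
Williamson `d`-transform of `F`. -/
def williamsonDF (d : ℕ) (F : StieltjesFunction ℝ) (x : ℝ) : ℝ :=
  if x < 0 then 0 else 1 - williamson d F x

/-- `F` is in the maximum domain of attraction of `G`: for some `c n > 0` and `b n`, the functions
`x ↦ F (c n * x + b n) ^ n` converge weakly to `G`, that is, at each continuity point of `G`. -/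
def InMDA (F G : ℝ → ℝ) : Prop :=
  ∃ c b : ℕ → ℝ, (∀ n, 0 < c n) ∧
    ∀ x, ContinuousAt G x → Tendsto (fun n : ℕ => F (c n * x + b n) ^ n) atTop (𝓝 (G x))

/-- The Gumbel distribution function. -/
def gumbel (x : ℝ) : ℝ := Real.exp (-Real.exp (-x))

/-- The right endpoint `sup {x | F x < 1}` of a distribution function, possibly infinite. -/
def rightEndpoint (F : ℝ → ℝ) : EReal := sSup ((fun x : ℝ => (x : EReal)) '' {x : ℝ | F x < 1})

/-- The filter on `ℝ` for limits `x ↑ e`, where `e` may be infinite. -/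
def upTo (e : EReal) : Filter ℝ := comap (fun x : ℝ => (x : EReal)) (𝓝[<] e)

/-- `a` is an auxiliary function (in the sense of the Gumbel domain) of the distribution function
`F`, or equivalently of its survival function `1 - F`. -/
def IsAuxiliaryFunction (F a : ℝ → ℝ) : Prop :=
  (∀ x : ℝ, (x : EReal) < rightEndpoint F → 0 < a x) ∧
  Tendsto (fun x => a x / x) (upTo (rightEndpoint F)) (𝓝 0) ∧
  ∀ t : ℝ, Tendsto (fun x => (1 - F (x + a x * t)) / (1 - F x)) (upTo (rightEndpoint F))
    (𝓝 (Real.exp (-t)))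

/-- The function `x ↦ (∫_x^e (1 - G t) dt) / (1 - G x)`. If the integral diverges, Lean's value
is `0`, so that positivity of this function for `x < e` contains the convergence of the integral. -/
def meanExcess (e : EReal) (G : ℝ → ℝ) (x : ℝ) : ℝ :=
  (∫ t in {t : ℝ | x < t ∧ (t : EReal) < e}, (1 - G t)) / (1 - G x)

/-- `f` is monotone (non-decreasing or non-increasing) on `(x₀, e)` for some `x₀ < e`. -/
def MonotoneNearLeft (f : ℝ → ℝ) (e : EReal) : Prop :=
  ∃ x₀ : ℝ, (x₀ : EReal) < e ∧
    (MonotoneOn f {x : ℝ | x₀ < x ∧ (x : EReal) < e} ∨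
      AntitoneOn f {x : ℝ | x₀ < x ∧ (x : EReal) < e})

end

/-!
A survival function `g` belongs to the Gumbel domain of attraction exactly when it is `Γ`-varying:
`g (x + a x * t) / g x → exp (-t)` as `x ↑ e` for some positive `a`. Then `a` may be replaced by any
asymptotically equivalent function, and the mean excess function of `g` is one. It therefore
suffices that the survival function of `F` and the transform `ψ` are `Γ`-varying with the same
auxiliary functions. With `n = d - 1`, both are governed by the partial moments
`M j x = ∫_{(x, ∞)} t⁻ⁿ (t - x) ^ j dF(t)`, since `ψ = M n`.

If the survival function is `Γ`-varying, integration by parts and dominated convergence, the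
dominating function coming from a Potter bound, give `ψ x ~ n! (a x / x) ^ n (1 - F x)`, where the
factor `(a x / x) ^ n` is asymptotically constant on the scale `a`.

Conversely, for `j ≥ 1`, `M j` is convex with right derivative `-j M (j - 1)`, and a monotone
density argument passes `Γ`-variation from `M j` down to `M (j - 1)`, with
`M j x ~ j (a x) M (j - 1) x`.
As `a x / x → 0`, the term `j = 0` dominates the binomial expansion
`1 - F x = ∑ j, (n choose j) x ^ (n - j) M j x`, so that `1 - F x ~ x ^ n M 0 x`.
-/

theorem tendsto_of_forall_eventually_le {ι : Type*} {l : Filter ι} {ρ : ι → ℝ} {z : ℝ → ι → ℝ}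
    {φ : ℝ → ℝ} {t : ℝ} (hφ : ContinuousAt φ t) (hz : ∀ s ≠ t, Tendsto (z s) l (𝓝 (φ s)))
    (hlt : ∀ s < t, ∀ᶠ i in l, ρ i ≤ z s i) (hgt : ∀ s > t, ∀ᶠ i in l, z s i ≤ ρ i) :
    Tendsto ρ l (𝓝 (φ t)) := by
  refine tendsto_order.2 ⟨fun b hb => ?_, fun b hb => ?_⟩
  · obtain ⟨s, hbs, hts⟩ := ((hφ.eventually (lt_mem_nhds hb)).filter_mono
      (nhdsWithin_le_nhds (s := Ioi t)) |>.and self_mem_nhdsWithin).exists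
    filter_upwards [(hz s hts.ne').eventually (lt_mem_nhds hbs), hgt s hts] with i h₁ h₂
    exact h₁.trans_le h₂
  · obtain ⟨s, hbs, hts⟩ := ((hφ.eventually (gt_mem_nhds hb)).filter_mono
      (nhdsWithin_le_nhds (s := Iio t)) |>.and self_mem_nhdsWithin).exists
    filter_upwards [(hz s hts.ne).eventually (gt_mem_nhds hbs), hlt s hts] with i h₁ h₂
    exact h₂.trans_lt h₁

section UpTo

variable {e : EReal}

instance : (upTo e).IsCountablyGenerated := by
  unfold upTo; infer_instance

theorem hasBasis_upTo (he : ⊥ < e) :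
    (upTo e).HasBasis (fun y : ℝ => (y : EReal) < e) fun y => {x | y < x ∧ (x : EReal) < e} := by
  refine ((nhdsLT_basis_of_exists_lt ⟨⊥, he⟩).comap _).to_hasBasis (fun b hb => ?_) fun y hy => ?_
  · obtain ⟨y, hby, hye⟩ := EReal.lt_iff_exists_real_btwn.1 hb
    exact ⟨y, hye, fun x hx => ⟨hby.trans (EReal.coe_lt_coe hx.1), hx.2⟩⟩
  · exact ⟨y, hy, fun x hx => ⟨EReal.coe_lt_coe_iff.1 hx.1, hx.2⟩⟩

theorem upTo_neBot (he : ⊥ < e) : (upTo e).NeBot :=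
  (hasBasis_upTo he).neBot_iff.2 fun {_} hy =>
    let ⟨x, hyx, hxe⟩ := EReal.lt_iff_exists_real_btwn.1 hy
    ⟨x, EReal.coe_lt_coe_iff.1 hyx, hxe⟩

theorem eventually_upTo_lt (e : EReal) : ∀ᶠ x : ℝ in upTo e, (x : EReal) < e :=
  tendsto_comap.eventually self_mem_nhdsWithin

theorem eventually_upTo_gt {y : ℝ} (hy : (y : EReal) < e) : ∀ᶠ x in upTo e, y < x :=
  (tendsto_comap.eventually (mem_nhdsWithin_of_mem_nhds (lt_mem_nhds hy))).mono
    fun _ => EReal.coe_lt_coe_iff.1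

end UpTo

/-- `g` is the survival function `x ↦ P(X > x)` of a real random variable with essential supremum
`e`, up to one-sided continuity and without the requirement that `g` vanish at `+∞`. -/
structure IsSurvivalFunction (g : ℝ → ℝ) (e : EReal) : Prop where
  antitone : Antitone g
  nonneg : ∀ x, 0 ≤ g x
  tendsto_atBot : Tendsto g atBot (𝓝 1)
  pos_iff : ∀ {x : ℝ}, 0 < g x ↔ (x : EReal) < e

/-- `g` is `Γ`-varying along `l`, the analogue for Gumbel limits of regular variation, with the
auxiliary function `a`. -/
structure GammaVarying (g a : ℝ → ℝ) (l : Filter ℝ) : Prop where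
  aux_pos : ∀ x, 0 < a x
  tendsto_div : ∀ t, Tendsto (fun x => g (x + a x * t) / g x) l (𝓝 (Real.exp (-t)))

namespace IsSurvivalFunction

variable {g a : ℝ → ℝ} {e : EReal}

theorem le_one (hg : IsSurvivalFunction g e) (x : ℝ) : g x ≤ 1 :=
  hg.antitone.ge_of_tendsto hg.tendsto_atBot x

theorem bot_lt (hg : IsSurvivalFunction g e) : ⊥ < e :=
  let ⟨_, hx⟩ := (hg.tendsto_atBot.eventually (lt_mem_nhds one_pos)).exists
  bot_le.trans_lt (hg.pos_iff.1 hx)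

theorem eq_zero_of_le (hg : IsSurvivalFunction g e) {x : ℝ} (hx : e ≤ x) : g x = 0 :=
  (hg.nonneg x).eq_of_not_lt' fun h => hx.not_gt (hg.pos_iff.1 h)

theorem measurable_comp_affine (hg : IsSurvivalFunction g e) (x c : ℝ) :
    Measurable fun u => g (x + c * u) :=
  hg.antitone.measurable.comp (by fun_prop)

theorem eventually_pos (hg : IsSurvivalFunction g e) : ∀ᶠ x in upTo e, 0 < g x :=
  (eventually_upTo_lt e).mono fun _ => hg.pos_iff.2

theorem tendsto_zero_of_forall_exists (hg : IsSurvivalFunction g e)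
    (h : ∀ ε > 0, ∃ x, 0 < g x ∧ g x < ε) : Tendsto g (upTo e) (𝓝 0) := by
  refine tendsto_order.2 ⟨fun b hb => Eventually.of_forall fun x => hb.trans_le (hg.nonneg x),
    fun b hb => ?_⟩
  obtain ⟨y, hy, hyb⟩ := h b hb
  filter_upwards [eventually_upTo_gt (hg.pos_iff.1 hy)] with x hx
  exact (hg.antitone hx.le).trans_lt hyb

theorem tendsto_upTo {ι : Type*} {l : Filter ι} {u : ι → ℝ} (hg : IsSurvivalFunction g e)
    (hpos : ∀ᶠ i in l, 0 < g (u i)) (hzero : Tendsto (fun i => g (u i)) l (𝓝 0)) :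
    Tendsto u l (upTo e) := by
  refine (hasBasis_upTo hg.bot_lt).tendsto_right_iff.2 fun y hy => ?_
  filter_upwards [hpos, hzero.eventually (gt_mem_nhds (hg.pos_iff.2 hy))] with i hi hiy
  exact ⟨hg.antitone.reflect_lt hiy, hg.pos_iff.1 hi⟩

theorem eventually_lt_of_tendsto_div {u v : ℝ → ℝ} {α β : ℝ} (hg : IsSurvivalFunction g e)
    (hu : Tendsto (fun x => g (u x) / g x) (upTo e) (𝓝 α))
    (hv : Tendsto (fun x => g (v x) / g x) (upTo e) (𝓝 β)) (h : α < β) :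
    ∀ᶠ x in upTo e, v x < u x := by
  filter_upwards [hu.eventually_lt hv h, hg.eventually_pos] with x hx hpos
  exact hg.antitone.reflect_lt ((div_lt_div_iff_of_pos_right hpos).1 hx)

theorem eventually_half (hg : IsSurvivalFunction g e) (h : GammaVarying g a (upTo e)) :
    ∀ᶠ x in upTo e, 0 < g (x + a x) ∧ g (x + a x) ≤ g x / 2 := by
  have hexp : Real.exp (-1) < 1 / 2 := by
    have := Real.exp_neg_one_lt_d9
    linarith
  have hdiv := h.tendsto_div 1
  simp only [mul_one] at hdiv
  filter_upwards [hdiv.eventually (gt_mem_nhds hexp),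
    hdiv.eventually (lt_mem_nhds (Real.exp_pos _)), hg.eventually_pos] with x hlt hpos hgx
  rw [div_lt_iff₀ hgx] at hlt
  exact ⟨(div_pos_iff_of_pos_right hgx).1 hpos, by linarith⟩

theorem tendsto_zero (hg : IsSurvivalFunction g e) (h : GammaVarying g a (upTo e)) :
    Tendsto g (upTo e) (𝓝 0) := by
  obtain ⟨y, hy, hhalf⟩ := (hasBasis_upTo hg.bot_lt).eventually_iff.1 (hg.eventually_half h)
  have hiter (k : ℕ) : ∃ x, y < x ∧ 0 < g x ∧ g x ≤ (1 / 2) ^ k := by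
    induction k with
    | zero =>
      obtain ⟨x, hyx, hxe⟩ := EReal.lt_iff_exists_real_btwn.1 hy
      exact ⟨x, EReal.coe_lt_coe_iff.1 hyx, hg.pos_iff.2 hxe, by simpa using hg.le_one x⟩
    | succ k ih =>
      obtain ⟨x, hyx, hpos, hle⟩ := ih
      obtain ⟨hpos', hle'⟩ := hhalf ⟨hyx, hg.pos_iff.1 hpos⟩
      refine ⟨x + a x, by linarith [h.aux_pos x], hpos', ?_⟩
      rw [pow_succ]
      linarith
  refine hg.tendsto_zero_of_forall_exists fun ε hε => ?_
  obtain ⟨k, hk⟩ := exists_pow_lt_of_lt_one hε (by norm_num : (1 / 2 : ℝ) < 1)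
  obtain ⟨x, -, hpos, hle⟩ := hiter k
  exact ⟨x, hpos, hle.trans_lt hk⟩

theorem tendsto_shift (hg : IsSurvivalFunction g e) (h : GammaVarying g a (upTo e)) (t : ℝ) :
    Tendsto (fun x => x + a x * t) (upTo e) (upTo e) := by
  refine hg.tendsto_upTo ?_ ?_
  · filter_upwards [(h.tendsto_div t).eventually (lt_mem_nhds (Real.exp_pos _)),
      hg.eventually_pos] with x hdiv hpos
    exact (div_pos_iff_of_pos_right hpos).1 hdiv
  · have hmul := (h.tendsto_div t).mul (hg.tendsto_zero h)
    rw [mul_zero] at hmul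
    refine hmul.congr' ?_
    filter_upwards [hg.eventually_pos] with x hpos
    exact div_mul_cancel₀ _ hpos.ne'

theorem tendsto_aux_div (hg : IsSurvivalFunction g e) (he : 0 < e)
    (h : GammaVarying g a (upTo e)) : Tendsto (fun x => a x / x) (upTo e) (𝓝 0) := by
  have hpos : ∀ᶠ x : ℝ in upTo e, 0 < x := eventually_upTo_gt he
  refine tendsto_order.2 ⟨fun b hb => ?_, fun b hb => ?_⟩
  · filter_upwards [hpos] with x hx
    exact hb.trans (div_pos (h.aux_pos x) hx)
  · filter_upwards [hpos, (hg.tendsto_shift h (-b⁻¹)).eventually hpos] with x hx hshift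
    have : 0 < b * x - a x := by
      calc 0 < b * (x + a x * -b⁻¹) := mul_pos hb hshift
        _ = b * x - a x := by field_simp; ring
    rw [div_lt_iff₀ hx]
    linarith

theorem tendsto_aux_shift_div_aux (hg : IsSurvivalFunction g e) (h : GammaVarying g a (upTo e))
    (s : ℝ) : Tendsto (fun x => a (x + a x * s) / a x) (upTo e) (𝓝 1) := by
  have htwice : Tendsto (fun x => g (x + a x * s + a (x + a x * s)) / g x) (upTo e)
      (𝓝 (Real.exp (-(s + 1)))) := by
    have hmul := ((h.tendsto_div 1).comp (hg.tendsto_shift h s)).mul (h.tendsto_div s)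
    rw [← Real.exp_add, ← neg_add, add_comm] at hmul
    refine hmul.congr' ?_
    filter_upwards [(hg.tendsto_shift h s).eventually hg.eventually_pos] with x hx
    simp only [Function.comp_apply, mul_one]
    exact div_mul_div_cancel₀ hx.ne'
  refine tendsto_order.2 ⟨fun b hb => ?_, fun b hb => ?_⟩
  · filter_upwards [hg.eventually_lt_of_tendsto_div htwice (h.tendsto_div (s + b))
      (Real.exp_lt_exp.2 (by linarith))] with x hx
    rw [lt_div_iff₀ (h.aux_pos x)]
    linarith [mul_add (a x) s b, mul_comm b (a x)]
  · filter_upwards [hg.eventually_lt_of_tendsto_div (h.tendsto_div (s + b)) htwice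
      (Real.exp_lt_exp.2 (by linarith))] with x hx
    rw [div_lt_iff₀ (h.aux_pos x)]
    linarith [mul_add (a x) s b, mul_comm b (a x)]

/-- The convergence in `GammaVarying` is locally uniform because the limit is continuous and
`g` is monotone. -/
theorem tendsto_div_of_tendsto {u : ℝ → ℝ} {t : ℝ} (hg : IsSurvivalFunction g e)
    (h : GammaVarying g a (upTo e)) (hu : Tendsto u (upTo e) (𝓝 t)) :
    Tendsto (fun x => g (x + a x * u x) / g x) (upTo e) (𝓝 (Real.exp (-t))) := by
  refine tendsto_of_forall_eventually_le (φ := fun s => Real.exp (-s))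
    (by fun_prop) (fun s _ => h.tendsto_div s) (fun s hs => ?_) fun s hs => ?_
  · filter_upwards [hu.eventually (lt_mem_nhds hs)] with x hx
    have := h.aux_pos x
    exact div_le_div_of_nonneg_right (hg.antitone (by gcongr)) (hg.nonneg x)
  · filter_upwards [hu.eventually (gt_mem_nhds hs)] with x hx
    have := h.aux_pos x
    exact div_le_div_of_nonneg_right (hg.antitone (by gcongr)) (hg.nonneg x)

theorem tendsto_div_of_aux_equivalent {a' : ℝ → ℝ} (hg : IsSurvivalFunction g e)
    (h : GammaVarying g a (upTo e)) (h' : Tendsto (fun x => a' x / a x) (upTo e) (𝓝 1)) (t : ℝ) :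
    Tendsto (fun x => g (x + a' x * t) / g x) (upTo e) (𝓝 (Real.exp (-t))) := by
  have hu : Tendsto (fun x => a' x / a x * t) (upTo e) (𝓝 t) := by
    simpa using h'.mul_const t
  refine (hg.tendsto_div_of_tendsto h hu).congr fun x => ?_
  rw [← mul_assoc, mul_div_cancel₀ _ (h.aux_pos x).ne']

theorem mul_pow_le_two_mul {u x δ : ℝ} {p : ℕ} (hg : IsSurvivalFunction g e) (ha : 0 ≤ a x)
    (hδ : 0 ≤ δ) (hp : (1 + δ) ^ p ≤ 2) (hu : u ∈ Icc 0 1) :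
    g (x + a x * u) * (1 + δ * u) ^ p ≤ 2 * g x := by
  have hle : x ≤ x + a x * u := le_add_of_nonneg_right (mul_nonneg ha hu.1)
  have hpow : (1 + δ * u) ^ p ≤ 2 :=
    (pow_le_pow_left₀ (by have := mul_nonneg hδ hu.1; positivity)
      (by linarith [mul_le_of_le_one_right hδ hu.2]) p).trans hp
  calc g (x + a x * u) * (1 + δ * u) ^ p
      ≤ g x * 2 := mul_le_mul (hg.antitone hle) hpow
        (pow_nonneg (by have := mul_nonneg hδ hu.1; positivity) p) (hg.nonneg x)
    _ = 2 * g x := mul_comm _ _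

theorem potter_step {x t δ : ℝ} {p : ℕ} (hg : IsSurvivalFunction g e) (hδ : 0 < δ)
    (hp : (1 + δ) ^ p ≤ 2) (ht : 1 ≤ t) (hhalf : g (x + a x) ≤ g x / 2)
    (haux : a (x + a x) ≤ (1 + δ) * a x)
    (ih : g (x + a x + a (x + a x) * ((t - 1) / (1 + δ))) *
      (1 + δ * ((t - 1) / (1 + δ))) ^ p ≤ 2 * g (x + a x)) :
    g (x + a x * t) * (1 + δ * t) ^ p ≤ 2 * g x := by
  set s := (t - 1) / (1 + δ) with hs
  have hs0 : 0 ≤ s := div_nonneg (by linarith) (by linarith)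
  have hts : t = 1 + (1 + δ) * s := by rw [hs]; field_simp; ring
  have harg : x + a x + a (x + a x) * s ≤ x + a x * t := by
    rw [hts]
    linarith [mul_le_mul_of_nonneg_right haux hs0]
  calc g (x + a x * t) * (1 + δ * t) ^ p
      ≤ g (x + a x + a (x + a x) * s) * (1 + δ * t) ^ p := by gcongr; exact hg.antitone harg
    _ = g (x + a x + a (x + a x) * s) * (1 + δ * s) ^ p * (1 + δ) ^ p := by
        rw [mul_assoc, ← mul_pow, hts]
        ring
    _ ≤ 2 * g (x + a x) * 2 :=
        mul_le_mul ih hp (by positivity) (mul_nonneg zero_le_two (hg.nonneg _))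
    _ ≤ 2 * g x := by linarith

theorem potter_of_forall_gt {y δ : ℝ} {p : ℕ} (hg : IsSurvivalFunction g e) (ha : ∀ x, 0 < a x)
    (hδ : 0 < δ) (hp : (1 + δ) ^ p ≤ 2)
    (hstep : ∀ x > y, 0 < g x → g (x + a x) ≤ g x / 2 ∧ a (x + a x) ≤ (1 + δ) * a x) (k : ℕ) :
    ∀ x > y, ∀ t ≥ 0, 1 + δ * t ≤ (1 + δ) ^ (k + 1) →
      g (x + a x * t) * (1 + δ * t) ^ p ≤ 2 * g x := by
  induction k with
  | zero =>
    intro x _ t ht htk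
    rw [zero_add, pow_one] at htk
    exact hg.mul_pow_le_two_mul (ha x).le hδ.le hp ⟨ht, by nlinarith⟩
  | succ k ih =>
    intro x hx t ht htk
    rcases le_total t 1 with ht1 | ht1
    · exact hg.mul_pow_le_two_mul (ha x).le hδ.le hp ⟨ht, ht1⟩
    rcases (hg.nonneg x).eq_or_lt with hzero | hpos
    · have hle : g (x + a x * t) ≤ 0 :=
        hzero ▸ hg.antitone (le_add_of_nonneg_right (mul_nonneg (ha x).le ht))
      rw [hle.antisymm (hg.nonneg _), ← hzero, zero_mul, mul_zero]
    obtain ⟨hhalf, haux⟩ := hstep x hx hpos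
    refine hg.potter_step hδ hp ht1 hhalf haux
      (ih _ (by linarith [ha x]) _ (div_nonneg (by linarith) (by linarith)) ?_)
    refine le_of_mul_le_mul_left ?_ (by linarith : 0 < 1 + δ)
    calc (1 + δ) * (1 + δ * ((t - 1) / (1 + δ))) = 1 + δ * t := by field_simp; ring
      _ ≤ (1 + δ) * (1 + δ) ^ (k + 1) := by rwa [← pow_succ']

/-- Each step `x ↦ x + a x` at least halves `g` and increases `a` by a factor of at most `1 + δ`,
where `(1 + δ) ^ p ≤ 2`. -/
theorem exists_potter (hg : IsSurvivalFunction g e) (h : GammaVarying g a (upTo e)) (p : ℕ) :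
    ∃ δ > 0, ∀ᶠ x in upTo e, ∀ t ≥ 0, g (x + a x * t) * (1 + δ * t) ^ p ≤ 2 * g x := by
  obtain ⟨δ, hp, hδ⟩ : ∃ δ : ℝ, (1 + δ) ^ p < 2 ∧ 0 < δ := by
    have hc : ContinuousAt (fun δ : ℝ => (1 + δ) ^ p) 0 := by fun_prop
    exact ((hc.eventually (gt_mem_nhds (show (1 + (0 : ℝ)) ^ p < 2 by simp))).filter_mono
      (nhdsWithin_le_nhds (s := Ioi 0)) |>.and self_mem_nhdsWithin).exists
  have hself := hg.tendsto_aux_shift_div_aux h 1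
  simp only [mul_one] at hself
  have hstep : ∀ᶠ x in upTo e, g (x + a x) ≤ g x / 2 ∧ a (x + a x) ≤ (1 + δ) * a x := by
    filter_upwards [hg.eventually_half h,
      hself.eventually (gt_mem_nhds (lt_add_of_pos_right 1 hδ))] with x hhalf hself
    exact ⟨hhalf.2, ((div_lt_iff₀ (h.aux_pos x)).1 hself).le⟩
  obtain ⟨y, hy, hstep⟩ := (hasBasis_upTo hg.bot_lt).eventually_iff.1 hstep
  refine ⟨δ, hδ, (eventually_upTo_gt hy).mono fun x hx t ht => ?_⟩
  obtain ⟨k, hk⟩ := pow_unbounded_of_one_lt (1 + δ * t) (lt_add_of_pos_right 1 hδ)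
  exact hg.potter_of_forall_gt h.aux_pos hδ hp.le
    (fun x hx hpos => hstep ⟨hx, hg.pos_iff.1 hpos⟩) k x hx t ht
    (hk.le.trans (pow_le_pow_right₀ (by linarith) k.le_succ))

theorem exists_integrableOn_bound (hg : IsSurvivalFunction g e) (h : GammaVarying g a (upTo e))
    (j : ℕ) : ∃ B : ℝ → ℝ, IntegrableOn B (Ioi 0) ∧
      ∀ᶠ x in upTo e, ∀ u > 0, u ^ j * (g (x + a x * u) / g x) ≤ B u := by
  obtain ⟨δ, hδ, hpotter⟩ := hg.exists_potter h (j + 2)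
  refine ⟨fun u => 2 * δ⁻¹ ^ j * (1 + (δ * u) ^ 2)⁻¹,
    ((integrable_inv_one_add_sq.comp_mul_left' hδ.ne').const_mul _).integrableOn, ?_⟩
  filter_upwards [hpotter, hg.eventually_pos] with x hx hpos u hu
  have hδu : 0 < δ * u := mul_pos hδ hu
  have hdiv : g (x + a x * u) / g x ≤ 2 * ((1 + δ * u) ^ (j + 2))⁻¹ := by
    rw [div_le_iff₀ hpos, mul_right_comm, ← div_eq_mul_inv, le_div_iff₀ (by positivity)]
    exact hx u hu.le
  have hpow : u ^ j ≤ δ⁻¹ ^ j * (1 + δ * u) ^ j := by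
    rw [← mul_pow, inv_mul_eq_div]
    refine pow_le_pow_left₀ (le_of_lt hu) ?_ j
    rw [le_div_iff₀ hδ]
    linarith
  have hsq : 1 + (δ * u) ^ 2 ≤ (1 + δ * u) ^ 2 := by nlinarith
  calc u ^ j * (g (x + a x * u) / g x)
      ≤ (δ⁻¹ ^ j * (1 + δ * u) ^ j) * (2 * ((1 + δ * u) ^ (j + 2))⁻¹) :=
        mul_le_mul hpow hdiv (div_nonneg (hg.nonneg _) hpos.le) (by positivity)
    _ = 2 * δ⁻¹ ^ j * ((1 + δ * u) ^ 2)⁻¹ := by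
        rw [pow_add]
        field_simp
    _ ≤ 2 * δ⁻¹ ^ j * (1 + (δ * u) ^ 2)⁻¹ := by gcongr

theorem tendsto_setIntegral_mul_div {j : ℕ} {k : ℝ → ℝ → ℝ} {k₀ : ℝ → ℝ} {C : ℝ}
    (hg : IsSurvivalFunction g e) (h : GammaVarying g a (upTo e)) (hkm : ∀ x, Measurable (k x))
    (hkb : ∀ᶠ x in upTo e, ∀ u > 0, |k x u| ≤ C * u ^ j)
    (hk : ∀ u > 0, Tendsto (fun x => k x u) (upTo e) (𝓝 (k₀ u))) :
    Tendsto (fun x => ∫ u in Ioi 0, k x u * (g (x + a x * u) / g x)) (upTo e)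
      (𝓝 (∫ u in Ioi 0, k₀ u * Real.exp (-u))) := by
  obtain ⟨B, hB, hbound⟩ := hg.exists_integrableOn_bound h j
  refine tendsto_integral_filter_of_dominated_convergence (fun u => |C| * B u)
    (Eventually.of_forall fun x =>
      ((hkm x).mul ((hg.measurable_comp_affine _ _).div_const _)).aestronglyMeasurable) ?_
    (hB.const_mul _) ?_
  · filter_upwards [hkb, hbound] with x hkx hBx
    refine ae_restrict_of_forall_mem measurableSet_Ioi fun u hu => ?_
    have hdiv : 0 ≤ g (x + a x * u) / g x := div_nonneg (hg.nonneg _) (hg.nonneg _)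
    have hu' : 0 ≤ u := le_of_lt hu
    rw [norm_mul, Real.norm_eq_abs, Real.norm_eq_abs, abs_of_nonneg hdiv]
    calc |k x u| * (g (x + a x * u) / g x)
        ≤ |C| * u ^ j * (g (x + a x * u) / g x) := by
          gcongr
          exact (hkx u hu).trans (by gcongr; exact le_abs_self C)
      _ = |C| * (u ^ j * (g (x + a x * u) / g x)) := mul_assoc _ _ _
      _ ≤ |C| * B u := by gcongr; exact hBx u hu
  · exact ae_restrict_of_forall_mem measurableSet_Ioi fun u hu => (hk u hu).mul (h.tendsto_div u)

end IsSurvivalFunction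

section AffineChangeOfVariables

variable {E : Type*} [NormedAddCommGroup E]

theorem indicator_Ioi_comp_affine (φ : ℝ → E) (x : ℝ) {c : ℝ} (hc : 0 < c) :
    (Ioi 0).indicator (fun u => φ (x + c * u)) =
      fun u => (fun v => (Ioi x).indicator φ (x + v)) (c * u) := by
  ext u
  simp [indicator, hc]

theorem integrableOn_Ioi_comp_affine_iff {φ : ℝ → E} {x c : ℝ} (hc : 0 < c) :
    IntegrableOn (fun u => φ (x + c * u)) (Ioi 0) ↔ IntegrableOn φ (Ioi x) := by
  rw [← integrable_indicator_iff measurableSet_Ioi, indicator_Ioi_comp_affine φ x hc,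
    integrable_comp_mul_left_iff (fun v => (Ioi x).indicator φ (x + v)) hc.ne',
    ← integrable_indicator_iff measurableSet_Ioi]
  exact ⟨fun h => by simpa using h.comp_add_left (-x), fun h => h.comp_add_left x⟩

theorem setIntegral_Ioi_eq_smul_comp_affine [NormedSpace ℝ E] (φ : ℝ → E) (x : ℝ) {c : ℝ}
    (hc : 0 < c) : ∫ s in Ioi x, φ s = c • ∫ u in Ioi 0, φ (x + c * u) := by
  rw [← integral_indicator measurableSet_Ioi, ← integral_indicator measurableSet_Ioi,
    indicator_Ioi_comp_affine φ x hc,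
    Measure.integral_comp_mul_left (fun v => (Ioi x).indicator φ (x + v)),
    integral_add_left_eq_self, abs_of_pos (inv_pos.2 hc), smul_inv_smul₀ hc.ne']

end AffineChangeOfVariables

namespace IsSurvivalFunction

variable {g a : ℝ → ℝ} {e : EReal}

theorem integrableOn_Ioi (hg : IsSurvivalFunction g e) (h : GammaVarying g a (upTo e)) (y : ℝ) :
    IntegrableOn g (Ioi y) := by
  have : (upTo e).NeBot := upTo_neBot hg.bot_lt
  obtain ⟨B, hB, hbound⟩ := hg.exists_integrableOn_bound h 0
  obtain ⟨x, hx, hpos⟩ := (hbound.and hg.eventually_pos).exists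
  have hdiv : IntegrableOn (fun u => g (x + a x * u) / g x) (Ioi 0) := by
    refine hB.mono' ((hg.measurable_comp_affine _ _).div_const _).aestronglyMeasurable
      (ae_restrict_of_forall_mem measurableSet_Ioi fun u hu => ?_)
    rw [Real.norm_eq_abs, abs_of_nonneg (div_nonneg (hg.nonneg _) (hg.nonneg _))]
    simpa using hx u hu
  have htail : IntegrableOn g (Ioi x) := by
    rw [← integrableOn_Ioi_comp_affine_iff (h.aux_pos x)]
    exact (hdiv.mul_const (g x)).congr
      (Eventually.of_forall fun u => div_mul_cancel₀ _ hpos.ne')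
  refine (((hg.antitone.antitoneOn (Icc y x)).integrableOn_isCompact isCompact_Icc).union
    htail).mono_set fun z hz => ?_
  exact (le_or_gt z x).imp (fun hzx => ⟨le_of_lt hz, hzx⟩) id

theorem setIntegral_Ioi_pos {x : ℝ} (hg : IsSurvivalFunction g e)
    (h : GammaVarying g a (upTo e)) (hx : (x : EReal) < e) : 0 < ∫ t in Ioi x, g t := by
  obtain ⟨y, hxy, hye⟩ := EReal.lt_iff_exists_real_btwn.1 hx
  rw [setIntegral_pos_iff_support_of_nonneg_ae (Eventually.of_forall hg.nonneg)
    (hg.integrableOn_Ioi h x)]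
  have hsub : Ioo x y ⊆ Function.support g ∩ Ioi x := fun z hz =>
    ⟨((hg.pos_iff.2 hye).trans_le (hg.antitone hz.2.le)).ne', hz.1⟩
  exact lt_of_lt_of_le (by simpa using hxy) (measure_mono hsub)

section MeanExcess

variable {G : ℝ → ℝ}

theorem meanExcess_eq (hg : IsSurvivalFunction (fun x => 1 - G x) e) (x : ℝ) :
    meanExcess e G x = (∫ t in Ioi x, (1 - G t)) / (1 - G x) := by
  unfold meanExcess
  congr 1
  refine (setIntegral_eq_of_subset_of_forall_sdiff_eq_zero measurableSet_Ioi
    (fun t ht => ht.1) fun t ht => hg.eq_zero_of_le ?_).symm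
  exact not_lt.1 fun hte => ht.2 ⟨ht.1, hte⟩

theorem meanExcess_pos {x : ℝ} (hg : IsSurvivalFunction (fun x => 1 - G x) e)
    (h : GammaVarying (fun x => 1 - G x) a (upTo e)) (hx : (x : EReal) < e) :
    0 < meanExcess e G x :=
  hg.meanExcess_eq x ▸ div_pos (hg.setIntegral_Ioi_pos h hx) (hg.pos_iff.2 hx)

theorem tendsto_meanExcess_div_aux (hg : IsSurvivalFunction (fun x => 1 - G x) e)
    (h : GammaVarying (fun x => 1 - G x) a (upTo e)) :
    Tendsto (fun x => meanExcess e G x / a x) (upTo e) (𝓝 1) := by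
  have hint := hg.tendsto_setIntegral_mul_div (j := 0) (k := fun _ _ => 1) (k₀ := fun _ => 1)
    (C := 1) h (fun _ => measurable_const) (by simp) (fun _ _ => tendsto_const_nhds)
  simp only [one_mul, integral_exp_neg_Ioi_zero] at hint
  refine hint.congr fun x => ?_
  rw [hg.meanExcess_eq, setIntegral_Ioi_eq_smul_comp_affine _ x (h.aux_pos x), integral_div,
    smul_eq_mul]
  have := (h.aux_pos x).ne'
  field_simp

end MeanExcess

end IsSurvivalFunction

theorem tendsto_natCast_mul_one_sub_of_tendsto_pow {p : ℕ → ℝ} {τ : ℝ} (hp : ∀ n, 0 ≤ p n)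
    (h : Tendsto (fun n => p n ^ n) atTop (𝓝 (Real.exp (-τ)))) :
    Tendsto (fun n : ℕ => n * (1 - p n)) atTop (𝓝 τ) := by
  have hpos : ∀ᶠ n in atTop, 0 < p n := by
    filter_upwards [h.eventually (lt_mem_nhds (Real.exp_pos _)), eventually_ne_atTop 0]
      with n hpow hn
    exact (hp n).lt_of_ne' fun hzero => by simp [hzero, hn] at hpow
  have hlog : Tendsto (fun n : ℕ => -(n * Real.log (p n))) atTop (𝓝 τ) := by
    simpa only [Real.log_exp, Real.log_pow, neg_neg] using (h.log (Real.exp_pos _).ne').neg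
  have hlog_zero : Tendsto (fun n => Real.log (p n)) atTop (𝓝 0) := by
    have hmul := hlog.neg.mul tendsto_inv_atTop_nhds_zero_nat
    rw [mul_zero] at hmul
    refine hmul.congr' ?_
    filter_upwards [eventually_ne_atTop 0] with n hn
    field_simp
  have hp_one : Tendsto p atTop (𝓝 1) := by
    have hexp := (Real.continuous_exp.tendsto 0).comp hlog_zero
    rw [Real.exp_zero] at hexp
    exact hexp.congr' (hpos.mono fun n hn => Real.exp_log hn)
  have hlower : Tendsto (fun n : ℕ => p n * -(n * Real.log (p n))) atTop (𝓝 τ) := by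
    simpa using hp_one.mul hlog
  refine tendsto_of_tendsto_of_tendsto_of_le_of_le' hlower hlog ?_ ?_
  · filter_upwards [hpos] with n hn
    have hle := mul_le_mul_of_nonneg_left (Real.one_sub_inv_le_log_of_pos hn) hn.le
    rw [mul_sub, mul_inv_cancel₀ hn.ne', mul_one] at hle
    nlinarith [Nat.cast_nonneg (α := ℝ) n]
  · filter_upwards [hpos] with n hn
    nlinarith [Nat.cast_nonneg (α := ℝ) n, Real.log_le_sub_one_of_pos hn]

namespace IsSurvivalFunction

variable {g a : ℝ → ℝ} {e : EReal}

theorem tendsto_zero_of_tendsto_natCast_mul {u : ℕ → ℝ} {τ : ℝ} (hg : IsSurvivalFunction g e)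
    (hτ : 0 < τ) (h : Tendsto (fun n : ℕ => n * g (u n)) atTop (𝓝 τ)) :
    Tendsto g (upTo e) (𝓝 0) := by
  have hzero : Tendsto (fun n => g (u n)) atTop (𝓝 0) := by
    have hmul := h.mul tendsto_inv_atTop_nhds_zero_nat
    rw [mul_zero] at hmul
    refine hmul.congr' ?_
    filter_upwards [eventually_ne_atTop 0] with n hn
    field_simp
  refine hg.tendsto_zero_of_forall_exists fun ε hε => ?_
  obtain ⟨n, hlt, hpos⟩ :=
    ((hzero.eventually (gt_mem_nhds hε)).and (h.eventually (lt_mem_nhds hτ))).exists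
  exact ⟨u n, pos_of_mul_pos_right hpos n.cast_nonneg, hlt⟩

/-- The auxiliary function is `y ↦ c ⌊1 / g y⌋₊`: with `n = ⌊1 / g y⌋₊`, the points `y` and `b n`
have asymptotically the same survival probability, so the norming `b n` may be replaced by `y`. -/
theorem exists_gammaVarying {c b : ℕ → ℝ} (hg : IsSurvivalFunction g e) (hc : ∀ n, 0 < c n)
    (h : ∀ x, Tendsto (fun n : ℕ => n * g (c n * x + b n)) atTop (𝓝 (Real.exp (-x)))) :
    ∃ a, GammaVarying g a (upTo e) := by
  have hinv : Tendsto (fun y => (g y)⁻¹) (upTo e) atTop :=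
    tendsto_inv_nhdsGT_zero.comp (tendsto_nhdsWithin_iff.2
      ⟨hg.tendsto_zero_of_tendsto_natCast_mul (Real.exp_pos _) (h 0), hg.eventually_pos⟩)
  set N : ℝ → ℕ := fun y => ⌊(g y)⁻¹⌋₊
  have hN : Tendsto N (upTo e) atTop := tendsto_nat_floor_atTop.comp hinv
  have hN_mul : Tendsto (fun y => N y * g y) (upTo e) (𝓝 1) :=
    ((tendsto_nat_floor_div_atTop (R := ℝ)).comp hinv).congr fun y => div_inv_eq_mul _ _
  have hdiv (s : ℝ) : Tendsto (fun y => g (c (N y) * s + b (N y)) / g y) (upTo e)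
      (𝓝 (Real.exp (-s))) := by
    have hquot := ((h s).comp hN).div hN_mul one_ne_zero
    rw [div_one] at hquot
    refine hquot.congr' ?_
    filter_upwards [hN.eventually (eventually_ne_atTop 0)] with y hy
    exact mul_div_mul_left _ _ (Nat.cast_ne_zero.2 hy)
  have hself : Tendsto (fun y => g y / g y) (upTo e) (𝓝 1) :=
    tendsto_const_nhds.congr' (hg.eventually_pos.mono fun y hy => (div_self hy.ne').symm)
  refine ⟨fun y => c (N y), fun y => hc _, fun t => ?_⟩
  refine tendsto_of_forall_eventually_le (φ := fun s => Real.exp (-s)) (by fun_prop)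
    (fun s _ => hdiv s) (fun s hs => ?_) fun s hs => ?_
  · filter_upwards [hg.eventually_lt_of_tendsto_div hself (hdiv (s - t))
      (Real.one_lt_exp_iff.2 (by linarith))] with y hy
    exact div_le_div_of_nonneg_right (hg.antitone (by linarith [mul_sub (c (N y)) s t]))
      (hg.nonneg y)
  · filter_upwards [hg.eventually_lt_of_tendsto_div (hdiv (s - t)) hself
      (Real.exp_lt_one_iff.2 (by linarith))] with y hy
    exact div_le_div_of_nonneg_right (hg.antitone (by linarith [mul_sub (c (N y)) s t]))
      (hg.nonneg y)

theorem exists_quantile {p : ℝ} (hg : IsSurvivalFunction g e) (hzero : Tendsto g (upTo e) (𝓝 0))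
    (hp : 0 < p) (hp' : p < 1) :
    ∃ b : ℝ, (b : EReal) < e ∧ (∀ x < b, p < g x) ∧ ∀ x > b, g x ≤ p := by
  have := upTo_neBot hg.bot_lt
  obtain ⟨z, hzp, hze⟩ := ((hzero.eventually (gt_mem_nhds hp)).and (eventually_upTo_lt e)).exists
  obtain ⟨w, hw⟩ := (hg.tendsto_atBot.eventually (lt_mem_nhds hp')).exists
  have hbdd : BddBelow {x | g x ≤ p} :=
    ⟨w, fun x hx => (hg.antitone.reflect_lt (lt_of_le_of_lt hx hw)).le⟩
  refine ⟨sInf {x | g x ≤ p}, ?_,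
    fun x hx => not_le.1 (notMem_of_lt_csInf (s := {x | g x ≤ p}) hx hbdd), fun x hx => ?_⟩
  · exact (EReal.coe_le_coe_iff.2 (csInf_le hbdd hzp.le)).trans_lt hze
  · obtain ⟨y, hy, hyx⟩ := exists_lt_of_csInf_lt ⟨z, hzp.le⟩ hx
    exact (hg.antitone hyx.le).trans hy

theorem tendsto_quantile {p b : ℕ → ℝ} (hg : IsSurvivalFunction g e)
    (hp : Tendsto p atTop (𝓝 0)) (hbe : ∀ n, (b n : EReal) < e)
    (hb : ∀ n, ∀ x > b n, g x ≤ p n) : Tendsto b atTop (upTo e) := by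
  refine (hasBasis_upTo hg.bot_lt).tendsto_right_iff.2 fun y hy => ?_
  obtain ⟨x, hyx, hxe⟩ := EReal.lt_iff_exists_real_btwn.1 hy
  filter_upwards [hp.eventually (gt_mem_nhds (hg.pos_iff.2 hxe))] with n hn
  have hxb : x ≤ b n := not_lt.1 fun hlt => hn.not_ge (hb n x hlt)
  exact ⟨(EReal.coe_lt_coe_iff.1 hyx).trans_le hxb, hbe n⟩

theorem exists_tendsto_natCast_mul (hg : IsSurvivalFunction g e)
    (h : GammaVarying g a (upTo e)) :
    ∃ b : ℕ → ℝ, ∀ x, Tendsto (fun n : ℕ => n * g (b n + a (b n) * x)) atTop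
      (𝓝 (Real.exp (-x))) := by
  set p : ℕ → ℝ := fun n => (n + 2 : ℝ)⁻¹ with hp
  have hp_pos (n : ℕ) : 0 < p n := by positivity
  have hp_lt (n : ℕ) : p n < 1 := inv_lt_one_of_one_lt₀ (by linarith [n.cast_nonneg (α := ℝ)])
  have hp_zero : Tendsto p atTop (𝓝 0) :=
    tendsto_inv_atTop_zero.comp (tendsto_atTop_add_const_right _ _ tendsto_natCast_atTop_atTop)
  choose b hbe hlt hge using fun n => hg.exists_quantile (hg.tendsto_zero h) (hp_pos n) (hp_lt n)
  have hb : Tendsto b atTop (upTo e) := hg.tendsto_quantile hp_zero hbe hge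
  have hquantile : Tendsto (fun n => p n / g (b n)) atTop (𝓝 1) := by
    rw [← Real.exp_zero, ← neg_zero]
    refine tendsto_of_forall_eventually_le (φ := fun s => Real.exp (-s)) (by fun_prop)
      (fun s _ => (h.tendsto_div s).comp hb) (fun s hs => ?_) fun s hs => ?_
    · refine Eventually.of_forall fun n => div_le_div_of_nonneg_right (hlt n _ ?_).le (hg.nonneg _)
      linarith [mul_neg_of_pos_of_neg (h.aux_pos (b n)) hs]
    · refine Eventually.of_forall fun n => div_le_div_of_nonneg_right (hge n _ ?_) (hg.nonneg _)
      linarith [mul_pos (h.aux_pos (b n)) hs]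
  refine ⟨b, fun x => ?_⟩
  have hlim := (((h.tendsto_div x).comp hb).div hquantile one_ne_zero).mul
    (tendsto_natCast_div_add_atTop (2 : ℝ))
  rw [div_one, mul_one] at hlim
  refine hlim.congr fun n => ?_
  have hgb : g (b n) ≠ 0 := (hg.pos_iff.2 (hbe n)).ne'
  simp only [Pi.div_apply, Function.comp_apply, hp]
  field_simp

theorem inMDA_gumbel_iff {G : ℝ → ℝ} (hg : IsSurvivalFunction (fun x => 1 - G x) e) :
    InMDA G gumbel ↔ ∃ a, GammaVarying (fun x => 1 - G x) a (upTo e) := by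
  constructor
  · rintro ⟨c, b, hc, hlim⟩
    refine hg.exists_gammaVarying (c := c) (b := b) hc fun x => ?_
    refine tendsto_natCast_mul_one_sub_of_tendsto_pow
      (fun n => sub_nonneg.1 ?_) (hlim x (by unfold gumbel; fun_prop))
    linarith [hg.le_one (c n * x + b n)]
  · rintro ⟨a, h⟩
    obtain ⟨b, hb⟩ := hg.exists_tendsto_natCast_mul h
    refine ⟨fun n => a (b n), b, fun n => h.aux_pos _, fun x _ => ?_⟩
    refine (Real.tendsto_one_add_pow_exp_of_tendsto ((hb x).neg.congr fun n =>
      (mul_neg _ _).symm)).congr fun n => ?_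
    rw [add_comm (b n)]
    ring

end IsSurvivalFunction

/-- `w` is a decrement density of `A` with respect to `B` on `s`, i.e. `-dA = w dB` with `w`
non-increasing: the decrease of `A` over an interval is the increase of `B` times a factor between
the values of `w` at the two endpoints. No continuity of `A`, `B` or `w` is required. -/
def IsDecrementDensity (w B A : ℝ → ℝ) (s : Set ℝ) : Prop :=
  ∀ ⦃x⦄, x ∈ s → ∀ ⦃y⦄, y ∈ s → x ≤ y →
    (B y - B x) * w y ≤ A x - A y ∧ A x - A y ≤ (B y - B x) * w x

theorem hasDerivWithinAt_of_sub_eq_mul {A B c : ℝ → ℝ} {x b c₀ : ℝ} {u : Set ℝ}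
    (h : ∀ᶠ y in 𝓝[u] x, A y - A x = c y * (B y - B x)) (hc : Tendsto c (𝓝[u] x) (𝓝 c₀))
    (hB : HasDerivWithinAt B b u x) : HasDerivWithinAt A (c₀ * b) u x := by
  rw [hasDerivWithinAt_iff_tendsto_slope] at hB ⊢
  refine ((hc.mono_left (nhdsWithin_mono _ sdiff_subset)).mul hB).congr' ?_
  filter_upwards [h.filter_mono (nhdsWithin_mono _ sdiff_subset)] with y hy
  rw [slope_def_field, slope_def_field, hy, mul_div_assoc]

namespace IsDecrementDensity

variable {w A B : ℝ → ℝ} {s u : Set ℝ} {x : ℝ}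

theorem exists_sub_eq_mul {y : ℝ} (h : IsDecrementDensity w B A s) (hx : x ∈ s) (hy : y ∈ s) :
    ∃ c ∈ uIcc (w x) (w y), A y - A x = -c * (B y - B x) := by
  suffices hmem : A x - A y ∈ uIcc (w x * (B y - B x)) (w y * (B y - B x)) by
    rw [← Set.image_mul_const_uIcc] at hmem
    obtain ⟨c, hc, hcA⟩ := hmem
    exact ⟨c, hc, by linarith⟩
  rcases le_total x y with hxy | hyx
  · obtain ⟨hlower, hupper⟩ := h hx hy hxy
    exact mem_uIcc_of_ge (by linarith) (by linarith)
  · obtain ⟨hlower, hupper⟩ := h hy hx hyx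
    exact mem_uIcc_of_ge (by linarith) (by linarith)

theorem exists_tendsto (h : IsDecrementDensity w B A s) (hx : x ∈ s) (hu : s ∈ 𝓝[u] x)
    (hw : ContinuousWithinAt w u x) :
    ∃ c : ℝ → ℝ, Tendsto c (𝓝[u] x) (𝓝 (-w x)) ∧
      ∀ᶠ y in 𝓝[u] x, A y - A x = c y * (B y - B x) := by
  have hex (y : ℝ) : ∃ c, y ∈ s → c ∈ uIcc (w x) (w y) ∧ A y - A x = -c * (B y - B x) := by
    by_cases hy : y ∈ s
    · obtain ⟨c, hc⟩ := h.exists_sub_eq_mul hx hy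
      exact ⟨c, fun _ => hc⟩
    · exact ⟨0, fun hy' => absurd hy' hy⟩
  choose c hc using hex
  refine ⟨fun y => -c y, Tendsto.neg ?_, by filter_upwards [hu] with y hy using (hc y hy).2⟩
  rw [tendsto_iff_dist_tendsto_zero]
  refine squeeze_zero' (Eventually.of_forall fun _ => dist_nonneg) ?_
    (tendsto_iff_dist_tendsto_zero.1 hw)
  filter_upwards [hu] with y hy
  exact abs_sub_left_of_mem_uIcc (hc y hy).1

theorem hasDerivWithinAt {b : ℝ} (h : IsDecrementDensity w B A s) (hx : x ∈ s)
    (hu : s ∈ 𝓝[u] x) (hw : ContinuousWithinAt w u x) (hB : HasDerivWithinAt B b u x) :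
    HasDerivWithinAt A (-w x * b) u x := by
  obtain ⟨c, hc, hAB⟩ := h.exists_tendsto hx hu hw
  exact hasDerivWithinAt_of_sub_eq_mul hAB hc hB

theorem differentiableWithinAt_iff (h : IsDecrementDensity w B A s) (hx : x ∈ s)
    (hu : s ∈ 𝓝[u] x) (hw : ContinuousWithinAt w u x) (hwx : w x ≠ 0) :
    DifferentiableWithinAt ℝ A u x ↔ DifferentiableWithinAt ℝ B u x := by
  obtain ⟨c, hc, hAB⟩ := h.exists_tendsto hx hu hw
  have hBA : ∀ᶠ y in 𝓝[u] x, B y - B x = (c y)⁻¹ * (A y - A x) := by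
    filter_upwards [hAB, hc.eventually_ne (neg_ne_zero.2 hwx)] with y hy hcy
    rw [hy, inv_mul_cancel_left₀ hcy]
  exact ⟨fun hA => (hasDerivWithinAt_of_sub_eq_mul hBA (hc.inv₀ (neg_ne_zero.2 hwx))
      hA.hasDerivWithinAt).differentiableWithinAt,
    fun hB => (h.hasDerivWithinAt hx hu hw hB.hasDerivWithinAt).differentiableWithinAt⟩

theorem continuousWithinAt (h : IsDecrementDensity w B A s) (hx : x ∈ s) (hu : s ∈ 𝓝[u] x)
    (hw : IsBoundedUnder (· ≤ ·) (𝓝[u] x) fun y => |w y|) (hB : ContinuousWithinAt B u x) :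
    ContinuousWithinAt A u x := by
  obtain ⟨M, hM⟩ := hw
  rw [ContinuousWithinAt, tendsto_iff_norm_sub_tendsto_zero] at hB ⊢
  have hlim := hB.const_mul (max |w x| M)
  rw [mul_zero] at hlim
  refine squeeze_zero' (Eventually.of_forall fun _ => norm_nonneg _) ?_ hlim
  filter_upwards [hu, eventually_map.1 hM] with y hy hyM
  obtain ⟨c, hc, hAB⟩ := h.exists_sub_eq_mul hx hy
  rw [hAB, norm_mul, norm_neg]
  gcongr
  calc |c| ≤ max |w x| |w y| := by
        rcases le_total (w x) (w y) with hle | hle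
        · rw [uIcc_of_le hle] at hc
          exact abs_le_max_abs_abs hc.1 hc.2
        · rw [uIcc_of_ge hle] at hc
          rw [max_comm]
          exact abs_le_max_abs_abs hc.1 hc.2
    _ ≤ max |w x| M := max_le_max_left _ hyM

theorem antitoneOn (h : IsDecrementDensity w id A s) : AntitoneOn w s := by
  intro x hx y hy hxy
  rcases hxy.eq_or_lt with rfl | hlt
  · exact le_rfl
  · obtain ⟨hlower, hupper⟩ := h hx hy hxy
    exact le_of_mul_le_mul_left (hlower.trans hupper) (sub_pos.2 hlt)

theorem continuousAt (h : IsDecrementDensity w id A s) (hs : s ∈ 𝓝 x) : ContinuousAt A x := by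
  rw [← continuousWithinAt_univ]
  refine h.continuousWithinAt (mem_of_mem_nhds hs) (by rwa [nhdsWithin_univ]) ?_
    continuousWithinAt_id
  obtain ⟨ε, hε, hsub⟩ := Metric.nhds_basis_closedBall.mem_iff.1 hs
  rw [Real.closedBall_eq_Icc] at hsub
  refine isBoundedUnder_of_eventually_le (a := max |w (x + ε)| |w (x - ε)|) ?_
  rw [nhdsWithin_univ]
  filter_upwards [Icc_mem_nhds (sub_lt_self x hε) (lt_add_of_pos_right x hε)] with y hy
  have hlast : x + ε ∈ s := hsub (right_mem_Icc.2 (hy.1.trans hy.2))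
  have hfirst : x - ε ∈ s := hsub (left_mem_Icc.2 (hy.1.trans hy.2))
  exact abs_le_max_abs_abs (h.antitoneOn (hsub hy) hlast hy.2)
    (h.antitoneOn hfirst (hsub hy) hy.1)

theorem hasDerivAt (h : IsDecrementDensity w id A s) (hs : s ∈ 𝓝 x) (hw : ContinuousAt w x) :
    HasDerivAt A (-w x) x := by
  rw [← hasDerivWithinAt_univ]
  simpa using h.hasDerivWithinAt (mem_of_mem_nhds hs) (by rwa [nhdsWithin_univ])
    hw.continuousWithinAt (hasDerivWithinAt_id x univ)

end IsDecrementDensity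

theorem sub_mul_pow_le_pow_sub_pow {p q : ℝ} (hq : 0 ≤ q) (hqp : q ≤ p) (j : ℕ) :
    (j + 1) * (p - q) * q ^ j ≤ p ^ (j + 1) - q ^ (j + 1) ∧
      p ^ (j + 1) - q ^ (j + 1) ≤ (j + 1) * (p - q) * p ^ j := by
  have hp := hq.trans hqp
  induction j with
  | zero => simp
  | succ j ih =>
    have hrec : p ^ (j + 1 + 1) - q ^ (j + 1 + 1) =
        p * (p ^ (j + 1) - q ^ (j + 1)) + (p - q) * q ^ (j + 1) := by ring
    rw [hrec]
    push_cast
    constructor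
    · have hlower := mul_le_mul hqp ih.1
        (mul_nonneg (mul_nonneg (by positivity) (sub_nonneg.2 hqp)) (by positivity)) hp
      linear_combination hlower
    · have hupper := mul_le_mul_of_nonneg_left ih.2 hp
      have hpow := mul_le_mul_of_nonneg_left (pow_le_pow_left₀ hq hqp (j + 1)) (sub_nonneg.2 hqp)
      linear_combination hupper + hpow

/-- The partial moment `∫_{(x, ∞)} t⁻ⁿ (t - x) ^ j dμ(t)`. For `j = n ≥ 1` it is the Williamson
`(n + 1)`-transform at `x > 0`, and up to a constant its derivatives are those with smaller `j`. -/
noncomputable def weightedTail (μ : Measure ℝ) (n j : ℕ) (x : ℝ) : ℝ :=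
  ∫ t in Ioi x, t⁻¹ ^ n * (t - x) ^ j ∂μ

theorem indicator_Ioi_sub_pow_bounds {x y t : ℝ} (hxy : x ≤ y) (hxt : x < t) (j : ℕ) :
    (y - x) * ((j + 1) * (Ioi y).indicator (fun t => (t - y) ^ j) t) ≤
        (t - x) ^ (j + 1) - (Ioi y).indicator (fun t => (t - y) ^ (j + 1)) t ∧
      (t - x) ^ (j + 1) - (Ioi y).indicator (fun t => (t - y) ^ (j + 1)) t ≤
        (y - x) * ((j + 1) * (t - x) ^ j) := by
  have hpos : 0 < t - x := sub_pos.2 hxt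
  rcases le_or_gt t y with hty | hyt
  · simp only [indicator_of_notMem (notMem_Ioi.2 hty), mul_zero, sub_zero]
    refine ⟨by positivity, ?_⟩
    calc (t - x) ^ (j + 1) ≤ (j + 1) * (t - x) * (t - x) ^ j := by
          simpa using (sub_mul_pow_le_pow_sub_pow le_rfl hpos.le j).2
      _ = (t - x) * ((j + 1) * (t - x) ^ j) := by ring
      _ ≤ (y - x) * ((j + 1) * (t - x) ^ j) := by gcongr
  · simp only [indicator_of_mem (mem_Ioi.2 hyt)]
    obtain ⟨hlower, hupper⟩ := sub_mul_pow_le_pow_sub_pow (sub_pos.2 hyt).le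
      (sub_le_sub_left hxy t) j
    rw [sub_sub_sub_cancel_left] at hlower hupper
    exact ⟨by linear_combination hlower, by linear_combination hupper⟩

section WeightedTail

variable {μ : Measure ℝ} {n j : ℕ} {x : ℝ}

theorem weightedTail_eq_setIntegral_indicator {y : ℝ} (hxy : x ≤ y) :
    weightedTail μ n j y =
      ∫ t in Ioi x, t⁻¹ ^ n * (Ioi y).indicator (fun t => (t - y) ^ j) t ∂μ := by
  simp only [← indicator_mul_right (Ioi y) fun t : ℝ => t⁻¹ ^ n]
  rw [setIntegral_indicator measurableSet_Ioi, Ioi_inter_Ioi, sup_eq_right.2 hxy, weightedTail]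

theorem weightedTail_self (hx : 0 < x) :
    weightedTail μ n n x = ∫ t in Ioi x, (1 - x / t) ^ n ∂μ := by
  refine setIntegral_congr_fun measurableSet_Ioi fun t ht => ?_
  have ht₀ : t ≠ 0 := (hx.trans ht).ne'
  rw [← mul_pow, mul_sub, inv_mul_cancel₀ ht₀, inv_mul_eq_div]

theorem weightedTail_nonneg (hx : 0 < x) : 0 ≤ weightedTail μ n j x :=
  setIntegral_nonneg measurableSet_Ioi fun _ ht =>
    mul_nonneg (pow_nonneg (inv_nonneg.2 (hx.trans ht).le) n) (pow_nonneg (sub_pos.2 ht).le j)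

variable [IsFiniteMeasure μ]

theorem integrableOn_weightedTail (hj : j ≤ n) (hx : 0 < x) :
    IntegrableOn (fun t => t⁻¹ ^ n * (t - x) ^ j) (Ioi x) μ := by
  refine Measure.integrableOn_of_bounded (M := x⁻¹ ^ (n - j)) (measure_ne_top _ _)
    (by fun_prop) ?_
  refine (ae_restrict_iff' measurableSet_Ioi).2 (Eventually.of_forall fun t ht => ?_)
  have ht₀ : 0 < t := hx.trans ht
  have hsub : 0 < t - x := sub_pos.2 ht
  have hratio : t⁻¹ * (t - x) ≤ 1 := by
    rw [inv_mul_eq_div, div_le_one ht₀]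
    linarith
  calc ‖t⁻¹ ^ n * (t - x) ^ j‖ = t⁻¹ ^ (n - j) * (t⁻¹ * (t - x)) ^ j := by
        rw [Real.norm_of_nonneg (by positivity), mul_pow, ← mul_assoc, ← pow_add,
          Nat.sub_add_cancel hj]
    _ ≤ t⁻¹ ^ (n - j) * 1 := by
        gcongr
        exact pow_le_one₀ (by positivity) hratio
    _ ≤ x⁻¹ ^ (n - j) := by
        rw [mul_one]
        exact pow_le_pow_left₀ (by positivity) (inv_anti₀ hx ht.le) _

theorem weightedTail_pos (hj : j ≤ n) (hx : 0 < x) (hμ : 0 < μ (Ioi x)) :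
    0 < weightedTail μ n j x := by
  have hpos : ∀ t ∈ Ioi x, 0 < t⁻¹ ^ n * (t - x) ^ j := fun t ht => by
    have ht₀ : 0 < t := hx.trans ht
    have hsub : 0 < t - x := sub_pos.2 ht
    positivity
  rw [weightedTail, setIntegral_pos_iff_support_of_nonneg_ae
    ((ae_restrict_iff' measurableSet_Ioi).2 (Eventually.of_forall fun t ht => (hpos t ht).le))
    (integrableOn_weightedTail hj hx)]
  exact hμ.trans_le (measure_mono fun t ht => ⟨(hpos t ht).ne', ht⟩)

theorem isDecrementDensity_weightedTail (hj : j + 1 ≤ n) :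
    IsDecrementDensity (fun x => (j + 1) * weightedTail μ n j x) id (weightedTail μ n (j + 1))
      (Ioi 0) := by
  intro x hx y hy hxy
  have hintegrable {i : ℕ} (hi : i ≤ n) :
      IntegrableOn (fun t => t⁻¹ ^ n * (Ioi y).indicator (fun t => (t - y) ^ i) t) (Ioi x) μ := by
    simp only [← indicator_mul_right (Ioi y) fun t : ℝ => t⁻¹ ^ n]
    exact (integrable_indicator_iff measurableSet_Ioi).2
      (integrableOn_weightedTail hi hy).restrict
  have hjn : j ≤ n := (Nat.le_succ j).trans hj
  have hsub := (integrableOn_weightedTail (μ := μ) hj hx).sub (hintegrable hj)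
  have hweight (t : ℝ) (ht : t ∈ Ioi x) : 0 ≤ t⁻¹ ^ n :=
    pow_nonneg (inv_nonneg.2 (hx.trans ht).le) n
  simp only [id]
  rw [weightedTail_eq_setIntegral_indicator hxy, weightedTail_eq_setIntegral_indicator hxy,
    weightedTail, weightedTail, ← integral_sub (integrableOn_weightedTail hj hx) (hintegrable hj)]
  simp only [← integral_const_mul]
  constructor
  · refine setIntegral_mono_on (((hintegrable hjn).const_mul _).const_mul _) hsub
      measurableSet_Ioi fun t ht => ?_
    linear_combination
      mul_le_mul_of_nonneg_left (indicator_Ioi_sub_pow_bounds hxy ht j).1 (hweight t ht)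
  · refine setIntegral_mono_on hsub (((integrableOn_weightedTail hjn hx).const_mul _).const_mul _)
      measurableSet_Ioi fun t ht => ?_
    linear_combination
      mul_le_mul_of_nonneg_left (indicator_Ioi_sub_pow_bounds hxy ht j).2 (hweight t ht)

theorem weightedTail_zero_sub {y : ℝ} (hx : 0 < x) (hxy : x ≤ y) :
    weightedTail μ n 0 x - weightedTail μ n 0 y = ∫ t in Ioc x y, t⁻¹ ^ n ∂μ := by
  have hint := integrableOn_weightedTail (μ := μ) (Nat.zero_le n) hx
  simp only [weightedTail, pow_zero, mul_one] at hint ⊢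
  rw [← Ioc_union_Ioi_eq_Ioi hxy] at hint ⊢
  rw [setIntegral_union Ioc_disjoint_Ioi_same measurableSet_Ioi
    (hint.mono_set subset_union_left) (hint.mono_set subset_union_right), add_sub_cancel_right]

theorem weightedTail_zero_sub_bounds {y : ℝ} (hx : 0 < x) (hxy : x ≤ y) :
    μ.real (Ioc x y) * y⁻¹ ^ n ≤ weightedTail μ n 0 x - weightedTail μ n 0 y ∧
      weightedTail μ n 0 x - weightedTail μ n 0 y ≤ μ.real (Ioc x y) * x⁻¹ ^ n := by
  have hint : IntegrableOn (fun t : ℝ => t⁻¹ ^ n) (Ioc x y) μ := by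
    simpa using (integrableOn_weightedTail (μ := μ) (Nat.zero_le n) hx).mono_set Ioc_subset_Ioi_self
  have hconst (c : ℝ) : IntegrableOn (fun _ => c) (Ioc x y) μ :=
    integrableOn_const (measure_ne_top _ _)
  rw [weightedTail_zero_sub hx hxy, ← smul_eq_mul, ← smul_eq_mul, ← setIntegral_const,
    ← setIntegral_const]
  constructor
  · refine setIntegral_mono_on (hconst _) hint measurableSet_Ioc fun t ht => ?_
    exact pow_le_pow_left₀ (inv_nonneg.2 (hx.le.trans hxy)) (inv_anti₀ (hx.trans ht.1) ht.2) n
  · refine setIntegral_mono_on hint (hconst _) measurableSet_Ioc fun t ht => ?_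
    exact pow_le_pow_left₀ (inv_nonneg.2 (hx.trans ht.1).le) (inv_anti₀ hx ht.1.le) n

theorem antitoneOn_weightedTail (hj : j ≤ n) : AntitoneOn (weightedTail μ n j) (Ioi 0) := by
  intro x hx y hy hxy
  cases j with
  | zero =>
    have hpow : 0 ≤ y⁻¹ ^ n := pow_nonneg (inv_nonneg.2 (le_of_lt hy)) n
    exact sub_nonneg.1 ((mul_nonneg measureReal_nonneg hpow).trans
      (weightedTail_zero_sub_bounds hx hxy).1)
  | succ j =>
    have hdensity := mul_nonneg (sub_nonneg.2 hxy)
      (mul_nonneg j.cast_add_one_pos.le (weightedTail_nonneg (μ := μ) (n := n) (j := j) hy))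
    exact sub_nonneg.1 (hdensity.trans (isDecrementDensity_weightedTail hj hx hy hxy).1)

theorem weightedTail_self_le (hx : 0 < x) : weightedTail μ n n x ≤ μ.real (Ioi x) := by
  rw [← mul_one (μ.real _), ← smul_eq_mul, ← setIntegral_const, weightedTail]
  refine setIntegral_mono_on (integrableOn_weightedTail le_rfl hx)
    (integrableOn_const (measure_ne_top _ _)) measurableSet_Ioi fun t ht => ?_
  have ht₀ : 0 < t := hx.trans ht
  rw [← mul_pow, inv_mul_eq_div]
  exact pow_le_one₀ (div_nonneg (sub_pos.2 ht).le ht₀.le) ((div_le_one ht₀).2 (by linarith))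

theorem measureReal_Ioi_eq_sum_weightedTail (n : ℕ) (hx : 0 < x) :
    μ.real (Ioi x) =
      ∑ j ∈ Finset.range (n + 1), n.choose j * x ^ (n - j) * weightedTail μ n j x := by
  simp only [weightedTail, ← integral_const_mul]
  rw [← integral_finsetSum _ fun j hj => (integrableOn_weightedTail
    (Nat.lt_succ_iff.1 (Finset.mem_range.1 hj)) hx).const_mul _,
    ← mul_one (μ.real _), ← smul_eq_mul, ← setIntegral_const]
  refine setIntegral_congr_fun measurableSet_Ioi fun t ht => ?_
  have ht₀ : t ≠ 0 := (hx.trans ht).ne'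
  calc (1 : ℝ) = t⁻¹ ^ n * (t - x + x) ^ n := by
        rw [sub_add_cancel, ← mul_pow, inv_mul_cancel₀ ht₀, one_pow]
    _ = _ := by
        rw [add_pow, Finset.mul_sum]
        exact Finset.sum_congr rfl fun j _ => by ring

end WeightedTail

section IntegrationByParts

variable {μ : Measure ℝ} {f f' : ℝ → ℝ} {x : ℝ}

theorem setLIntegral_Ioi_eq_setLIntegral_meas_mul_deriv (hcont : ContinuousOn f (Ici x))
    (hderiv : ∀ t ∈ Ioi x, HasDerivAt f (f' t) t) (hnonneg : ∀ t ∈ Ioi x, 0 ≤ f' t)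
    (hx : f x = 0) :
    ∫⁻ t in Ioi x, ENNReal.ofReal (f t) ∂μ =
      ∫⁻ u in Ioi 0, μ (Ioi (x + u)) * ENNReal.ofReal (f' (x + u)) := by
  have hshift {u : ℝ} (hu : 0 < u) : x + u ∈ Ioi x := lt_add_of_pos_right x hu
  have hcont' : ContinuousOn (fun u => f (x + u)) (Ici 0) :=
    hcont.comp (by fun_prop) fun u hu => mem_Ici.2 (le_add_of_nonneg_right hu)
  have hderiv' (u : ℝ) (hu : 0 < u) : HasDerivAt (fun u => f (x + u)) (f' (x + u)) u :=
    (hderiv _ (hshift hu)).comp_const_add x u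
  have hint (t : ℝ) (ht : 0 < t) : IntervalIntegrable (fun u => f' (x + u)) volume 0 t :=
    (intervalIntegrable_iff_integrableOn_Ioc_of_le ht.le).2
      (intervalIntegral.integrableOn_deriv_of_nonneg (hcont'.mono Icc_subset_Ici_self)
        (fun u hu => hderiv' u hu.1) fun u hu => hnonneg _ (hshift hu.1))
  have hprimitive (t : ℝ) (ht : t ∈ Ioi x) : ∫ u in (0 : ℝ)..t - x, f' (x + u) = f t := by
    have hpos : 0 < t - x := sub_pos.2 ht
    rw [intervalIntegral.integral_eq_sub_of_hasDerivAt_of_le hpos.le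
      (hcont'.mono Icc_subset_Ici_self) (fun u hu => hderiv' u hu.1) (hint _ hpos)]
    simp [hx]
  have hlayer := lintegral_comp_eq_lintegral_meas_lt_mul (μ.restrict (Ioi x)) (f := fun t => t - x)
    ((ae_restrict_iff' measurableSet_Ioi).2 (Eventually.of_forall fun t ht => (sub_pos.2 ht).le))
    (by fun_prop) hint
    ((ae_restrict_iff' measurableSet_Ioi).2
      (Eventually.of_forall fun u hu => hnonneg _ (hshift hu)))
  rw [setLIntegral_congr_fun measurableSet_Ioi fun t ht => by rw [hprimitive t ht]] at hlayer
  rw [hlayer]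
  refine setLIntegral_congr_fun measurableSet_Ioi fun u hu => ?_
  have hset : {t | u < t - x} = Ioi (x + u) := by
    ext t
    rw [mem_ofPred_eq, mem_Ioi, lt_sub_iff_add_lt']
  rw [hset, Measure.restrict_apply measurableSet_Ioi,
    inter_eq_left.2 (Ioi_subset_Ioi (hshift hu).le)]

theorem setIntegral_Ioi_eq_setIntegral_measureReal_mul_deriv [IsFiniteMeasure μ]
    (hcont : ContinuousOn f (Ici x)) (hderiv : ∀ t ∈ Ioi x, HasDerivAt f (f' t) t)
    (hnonneg : ∀ t ∈ Ioi x, 0 ≤ f' t) (hx : f x = 0) :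
    ∫ t in Ioi x, f t ∂μ = ∫ t in Ioi x, μ.real (Ioi t) * f' t := by
  have hshift {u : ℝ} (hu : 0 < u) : x + u ∈ Ioi x := lt_add_of_pos_right x hu
  have hf : ∀ t ∈ Ioi x, 0 ≤ f t := fun t ht => by
    rw [← hx]
    refine monotoneOn_of_deriv_nonneg (convex_Ici x) hcont ?_ ?_ self_mem_Ici
      (Ioi_subset_Ici_self ht) (le_of_lt ht)
    all_goals rw [interior_Ici]
    · exact fun s hs => (hderiv s hs).differentiableAt.differentiableWithinAt
    · exact fun s hs => (hderiv s hs).deriv ▸ hnonneg s hs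
  have hmeas : AEStronglyMeasurable (fun u => f' (x + u)) (volume.restrict (Ioi 0)) := by
    refine ((measurable_deriv f).comp (measurable_const_add x)).aestronglyMeasurable.congr ?_
    exact (ae_restrict_iff' measurableSet_Ioi).2
      (Eventually.of_forall fun u hu => (hderiv _ (hshift hu)).deriv)
  have htail : Measurable fun u => μ.real (Ioi (x + u)) :=
    Antitone.measurable fun u v huv => measureReal_mono (Ioi_subset_Ioi (by gcongr))
  rw [setIntegral_Ioi_eq_smul_comp_affine (fun t => μ.real (Ioi t) * f' t) x one_pos, one_smul]
  simp only [one_mul]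
  rw [integral_eq_lintegral_of_nonneg_ae
      ((ae_restrict_iff' measurableSet_Ioi).2 (Eventually.of_forall hf))
      ((hcont.mono Ioi_subset_Ici_self).aestronglyMeasurable measurableSet_Ioi),
    integral_eq_lintegral_of_nonneg_ae
      ((ae_restrict_iff' measurableSet_Ioi).2 (Eventually.of_forall fun u hu =>
        mul_nonneg measureReal_nonneg (hnonneg _ (hshift hu))))
      (htail.aestronglyMeasurable.mul hmeas),
    setLIntegral_Ioi_eq_setLIntegral_meas_mul_deriv hcont hderiv hnonneg hx]
  congr 1
  refine setLIntegral_congr_fun measurableSet_Ioi fun u _ => ?_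
  rw [ENNReal.ofReal_mul measureReal_nonneg, ofReal_measureReal]

end IntegrationByParts

theorem integral_succ_mul_pow_mul_exp_neg (n : ℕ) :
    ∫ u in Ioi (0 : ℝ), (n + 1) * u ^ n * Real.exp (-u) = (n + 1).factorial := by
  have hgamma := Real.Gamma_eq_integral (s := (n : ℝ) + 1) (by positivity)
  rw [Real.Gamma_nat_eq_factorial] at hgamma
  rw [Nat.factorial_succ, Nat.cast_mul, Nat.cast_succ, hgamma, ← integral_const_mul]
  refine setIntegral_congr_fun measurableSet_Ioi fun u _ => ?_
  rw [add_sub_cancel_right, Real.rpow_natCast]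
  ring

/-- `a` is positive, asymptotically constant along `l` on the scale `a` itself, and negligible with
respect to the identity. These are the properties of an auxiliary function that are shared by all
the functions it is auxiliary to. -/
structure IsSelfNeglecting (a : ℝ → ℝ) (l : Filter ℝ) : Prop where
  pos : ∀ x, 0 < a x
  tendsto_shift : ∀ t, Tendsto (fun x => x + a x * t) l l
  tendsto_shift_div : ∀ t, Tendsto (fun x => a (x + a x * t) / a x) l (𝓝 1)
  tendsto_div_id : Tendsto (fun x => a x / x) l (𝓝 0)
  eventually_id_pos : ∀ᶠ x in l, 0 < x

theorem IsSurvivalFunction.isSelfNeglecting {g a : ℝ → ℝ} {e : EReal}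
    (hg : IsSurvivalFunction g e) (he : 0 < e) (h : GammaVarying g a (upTo e)) :
    IsSelfNeglecting a (upTo e) :=
  ⟨h.aux_pos, hg.tendsto_shift h, hg.tendsto_aux_shift_div_aux h, hg.tendsto_aux_div he h,
    eventually_upTo_gt he⟩

theorem IsSelfNeglecting.tendsto_shift_id_div_id {a : ℝ → ℝ} {l : Filter ℝ}
    (hs : IsSelfNeglecting a l) (t : ℝ) : Tendsto (fun x => (x + a x * t) / x) l (𝓝 1) := by
  have hlim := (hs.tendsto_div_id.mul_const t).const_add 1
  rw [zero_mul, add_zero] at hlim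
  refine hlim.congr' ?_
  filter_upwards [hs.eventually_id_pos] with x hx
  rw [add_div, div_self hx.ne', div_mul_eq_mul_div]

namespace GammaVarying

variable {g g₁ r a : ℝ → ℝ} {l : Filter ℝ} {c : ℝ}

theorem of_tendsto_div (h : GammaVarying g a l) (hshift : ∀ t, Tendsto (fun x => x + a x * t) l l)
    (hr : ∀ t, Tendsto (fun x => r (x + a x * t) / r x) l (𝓝 1)) (hc : c ≠ 0)
    (hg₁ : Tendsto (fun x => g₁ x / (g x * r x)) l (𝓝 c)) : GammaVarying g₁ a l where
  aux_pos := h.aux_pos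
  tendsto_div t := by
    have hlim := (((hg₁.comp (hshift t)).div hg₁ hc).mul (h.tendsto_div t)).mul (hr t)
    rw [div_self hc, one_mul, mul_one] at hlim
    refine hlim.congr' ?_
    filter_upwards [hg₁.eventually_ne hc, (hshift t).eventually (hg₁.eventually_ne hc)]
      with x hx hxt
    obtain ⟨hg₁x, hgrx⟩ := div_ne_zero_iff.1 hx
    obtain ⟨hgx, hrx⟩ := mul_ne_zero_iff.1 hgrx
    obtain ⟨hgxt, hrxt⟩ := mul_ne_zero_iff.1 (div_ne_zero_iff.1 hxt).2
    simp only [Function.comp_apply, Pi.div_apply]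
    field_simp

theorem congr' (h : GammaVarying g a l) (hshift : ∀ t, Tendsto (fun x => x + a x * t) l l)
    (heq : g =ᶠ[l] g₁) : GammaVarying g₁ a l where
  aux_pos := h.aux_pos
  tendsto_div t := by
    refine (h.tendsto_div t).congr' ?_
    filter_upwards [heq, (hshift t).eventually heq] with x hx hxt
    rw [hx, hxt]

theorem of_const_mul (hc : c ≠ 0) (h : GammaVarying (fun x => c * g x) a l) :
    GammaVarying g a l :=
  ⟨h.aux_pos, fun t => (h.tendsto_div t).congr fun _ => mul_div_mul_left _ _ hc⟩

end GammaVarying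

section Abelian

variable {μ : Measure ℝ} [IsFiniteMeasure μ] {a : ℝ → ℝ} {e : EReal}

theorem weightedTail_succ_self_eq_setIntegral_measureReal_mul (n : ℕ) {x : ℝ} (hx : 0 < x) :
    weightedTail μ (n + 1) (n + 1) x =
      ∫ t in Ioi x, μ.real (Ioi t) * ((n + 1) * (1 - x / t) ^ n * (x / t ^ 2)) := by
  rw [weightedTail_self hx]
  have hderiv (t : ℝ) (ht : 0 < t) : HasDerivAt (fun t => (1 - x / t) ^ (n + 1))
      ((n + 1) * (1 - x / t) ^ n * (x / t ^ 2)) t := by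
    have hbase := ((hasDerivAt_inv ht.ne').const_mul x).const_sub 1
    simp only [← div_eq_mul_inv] at hbase
    refine (hbase.pow (n + 1)).congr_deriv ?_
    push_cast
    ring
  refine setIntegral_Ioi_eq_setIntegral_measureReal_mul_deriv
    (fun t ht => (hderiv t (hx.trans_le ht)).continuousAt.continuousWithinAt)
    (fun t ht => hderiv t (hx.trans ht)) (fun t ht => ?_) ?_
  · have hratio : 0 ≤ 1 - x / t := sub_nonneg.2 ((div_le_one (hx.trans ht)).2 (le_of_lt ht))
    positivity
  · rw [div_self hx.ne', sub_self, zero_pow n.succ_ne_zero]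

theorem weightedTail_succ_self_div_eq_setIntegral (n : ℕ) {x c : ℝ} (hx : 0 < x) (hc : 0 < c) :
    weightedTail μ (n + 1) (n + 1) x / (μ.real (Ioi x) * (c / x) ^ (n + 1)) =
      ∫ u in Ioi 0, (n + 1) * u ^ n * (x / (x + c * u)) ^ (n + 2) *
        (μ.real (Ioi (x + c * u)) / μ.real (Ioi x)) := by
  rw [weightedTail_succ_self_eq_setIntegral_measureReal_mul n hx,
    setIntegral_Ioi_eq_smul_comp_affine _ x hc, smul_eq_mul, mul_div_right_comm,
    ← integral_const_mul]
  refine setIntegral_congr_fun measurableSet_Ioi fun u (hu : 0 < u) => ?_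
  have hshift : 0 < x + c * u := by positivity
  have hratio : 1 - x / (x + c * u) = c * u / (x + c * u) := by
    rw [one_sub_div hshift.ne', add_sub_cancel_left]
  simp only [hratio, div_pow, mul_pow]
  field_simp
  ring

theorem tendsto_weightedTail_succ_self_div (n : ℕ)
    (hg : IsSurvivalFunction (fun x => μ.real (Ioi x)) e) (he : 0 < e)
    (h : GammaVarying (fun x => μ.real (Ioi x)) a (upTo e)) :
    Tendsto (fun x => weightedTail μ (n + 1) (n + 1) x / (μ.real (Ioi x) * (a x / x) ^ (n + 1)))
      (upTo e) (𝓝 (n + 1).factorial) := by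
  have hs := hg.isSelfNeglecting he h
  rw [← integral_succ_mul_pow_mul_exp_neg]
  refine (hg.tendsto_setIntegral_mul_div (j := n) (C := n + 1)
    (k := fun x u => (n + 1) * u ^ n * (x / (x + a x * u)) ^ (n + 2)) h
    (fun x => by fun_prop) ?_ fun u _ => ?_).congr' ?_
  · filter_upwards [hs.eventually_id_pos] with x hx u hu
    have hax := hs.pos x
    have hratio : x / (x + a x * u) ≤ 1 :=
      div_le_one_of_le₀ (le_add_of_nonneg_right (by positivity)) (by positivity)
    rw [abs_of_nonneg (by positivity)]
    exact mul_le_of_le_one_right (by positivity) (pow_le_one₀ (by positivity) hratio)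
  · have hlim := (((hs.tendsto_shift_id_div_id u).inv₀ one_ne_zero).pow (n + 2)).const_mul
      ((n + 1) * u ^ n)
    simpa only [inv_div, inv_one, one_pow, mul_one] using hlim
  · filter_upwards [hs.eventually_id_pos] with x hx
    exact (weightedTail_succ_self_div_eq_setIntegral n hx (hs.pos x)).symm

theorem gammaVarying_weightedTail_of_measureReal_Ioi (n : ℕ)
    (hg : IsSurvivalFunction (fun x => μ.real (Ioi x)) e) (he : 0 < e)
    (h : GammaVarying (fun x => μ.real (Ioi x)) a (upTo e)) :
    GammaVarying (weightedTail μ (n + 1) (n + 1)) a (upTo e) := by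
  have hs := hg.isSelfNeglecting he h
  refine h.of_tendsto_div (r := fun x => (a x / x) ^ (n + 1)) hs.tendsto_shift (fun t => ?_)
    (Nat.cast_ne_zero.2 (n + 1).factorial_ne_zero) (tendsto_weightedTail_succ_self_div n hg he h)
  have hlim := ((hs.tendsto_shift_div t).div (hs.tendsto_shift_id_div_id t) one_ne_zero).pow (n + 1)
  rw [div_one, one_pow] at hlim
  refine hlim.congr fun x => ?_
  rw [← div_pow, Pi.div_apply, div_div_div_comm]

end Abelian

section Tauberian

variable {a : ℝ → ℝ} {l : Filter ℝ}

/-- The convexity of `A` squeezes `w x` between the difference quotients of `A` over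
`[x, x + a x * s]` for `s > 0` and for `s < 0`, whose limits tend to `1` as `s → 0`. -/
theorem IsDecrementDensity.tendsto_aux_mul_div {w A : ℝ → ℝ}
    (hd : IsDecrementDensity w id A (Ioi 0)) (hs : IsSelfNeglecting a l)
    (hA : ∀ᶠ x in l, 0 < A x) (h : GammaVarying A a l) :
    Tendsto (fun x => a x * w x / A x) l (𝓝 1) := by
  have hderiv : HasDerivAt (fun t : ℝ => 1 - Real.exp (-t)) 1 0 := by
    simpa using (hasDerivAt_neg (0 : ℝ)).exp.const_sub 1
  have hslope {s : ℝ} (hs0 : s ≠ 0) :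
      dslope (fun t => 1 - Real.exp (-t)) 0 s = (1 - Real.exp (-s)) / s := by
    simp [dslope_of_ne _ hs0, slope_def_field]
  have hquotient {x s : ℝ} (hx : 0 < A x) : (1 - A (x + a x * s) / A x) / s =
      (A x - A (x + a x * s)) / s / A x := by
    rw [one_sub_div hx.ne', div_right_comm]
  rw [← hderiv.deriv, ← dslope_same]
  refine tendsto_of_forall_eventually_le (z := fun s x => (1 - A (x + a x * s) / A x) / s)
    (continuousAt_dslope_same.2 hderiv.differentiableAt) (fun s hs0 => ?_) (fun s hs0 => ?_)
    fun s hs0 => ?_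
  · rw [hslope hs0]
    exact ((h.tendsto_div s).const_sub 1).div_const s
  · filter_upwards [hA, hs.eventually_id_pos, (hs.tendsto_shift s).eventually hs.eventually_id_pos]
      with x hAx hx hxs
    have hle : x + a x * s ≤ x := by linarith [mul_neg_of_pos_of_neg (hs.pos x) hs0]
    have hdrop := (hd hxs hx hle).1
    simp only [id] at hdrop
    rw [hquotient hAx]
    gcongr
    rw [le_div_iff_of_neg hs0]
    linear_combination hdrop
  · filter_upwards [hA, hs.eventually_id_pos] with x hAx hx
    have hpos := mul_pos (hs.pos x) hs0
    have hdrop := (hd hx (add_pos hx hpos) (le_add_of_nonneg_right hpos.le)).2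
    simp only [id] at hdrop
    rw [hquotient hAx]
    gcongr
    rw [div_le_iff₀ hs0]
    linear_combination hdrop

theorem IsDecrementDensity.gammaVarying {w A : ℝ → ℝ} (hd : IsDecrementDensity w id A (Ioi 0))
    (hs : IsSelfNeglecting a l) (hA : ∀ᶠ x in l, 0 < A x) (h : GammaVarying A a l) :
    GammaVarying w a l := by
  refine h.of_tendsto_div (r := fun x => (a x)⁻¹) hs.tendsto_shift (fun t => ?_) one_ne_zero
    ((hd.tendsto_aux_mul_div hs hA h).congr fun x => ?_)
  · simpa only [inv_one, inv_div, inv_div_inv] using (hs.tendsto_shift_div t).inv₀ one_ne_zero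
  · rw [← div_eq_mul_inv, div_div_eq_mul_div, mul_comm]

variable {μ : Measure ℝ} [IsFiniteMeasure μ] {n j : ℕ}

theorem eventually_weightedTail_pos (hs : IsSelfNeglecting a l) (hμ : ∀ᶠ x in l, 0 < μ (Ioi x))
    (hj : j ≤ n) : ∀ᶠ x in l, 0 < weightedTail μ n j x := by
  filter_upwards [hμ, hs.eventually_id_pos] with x hμx hx using weightedTail_pos hj hx hμx

theorem gammaVarying_weightedTail_of_le (hs : IsSelfNeglecting a l)
    (hμ : ∀ᶠ x in l, 0 < μ (Ioi x)) (h : GammaVarying (weightedTail μ n n) a l) (hj : j ≤ n) :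
    GammaVarying (weightedTail μ n j) a l := by
  induction hj using Nat.decreasingInduction with
  | self => exact h
  | of_succ j hj ih =>
    exact ((isDecrementDensity_weightedTail hj).gammaVarying hs
      (eventually_weightedTail_pos hs hμ hj) ih).of_const_mul (by positivity)

theorem tendsto_weightedTail_div (hs : IsSelfNeglecting a l)
    (hμ : ∀ᶠ x in l, 0 < μ (Ioi x)) (h : GammaVarying (weightedTail μ n n) a l) (hj : j ≤ n) :
    Tendsto (fun x => weightedTail μ n j x / (x ^ j * weightedTail μ n 0 x)) l
      (𝓝 (if j = 0 then 1 else 0)) := by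
  induction j with
  | zero =>
    rw [if_pos rfl]
    refine tendsto_const_nhds.congr' ?_
    filter_upwards [eventually_weightedTail_pos hs hμ hj] with x hx
    rw [pow_zero, one_mul, div_self hx.ne']
  | succ j ih =>
    have hjn : j ≤ n := (Nat.le_succ j).trans hj
    have hdensity := (isDecrementDensity_weightedTail hj).tendsto_aux_mul_div hs
      (eventually_weightedTail_pos hs hμ hj) (gammaVarying_weightedTail_of_le hs hμ h hj)
    have hlim := (((hdensity.inv₀ one_ne_zero).mul hs.tendsto_div_id).mul (ih hjn)).const_mul
      ((j : ℝ) + 1)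
    rw [mul_zero, zero_mul, mul_zero] at hlim
    rw [if_neg (Nat.succ_ne_zero j)]
    refine hlim.congr' ?_
    filter_upwards [eventually_weightedTail_pos hs hμ hjn, hs.eventually_id_pos] with x hpos hx
    have hax := hs.pos x
    rw [inv_div, pow_succ]
    field_simp

theorem tendsto_measureReal_Ioi_div_weightedTail (hs : IsSelfNeglecting a l)
    (hμ : ∀ᶠ x in l, 0 < μ (Ioi x)) (h : GammaVarying (weightedTail μ n n) a l) :
    Tendsto (fun x => μ.real (Ioi x) / (weightedTail μ n 0 x * x ^ n)) l (𝓝 1) := by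
  have hlim : Tendsto (fun x => ∑ j ∈ Finset.range (n + 1), (n.choose j : ℝ) *
      (weightedTail μ n j x / (x ^ j * weightedTail μ n 0 x))) l
      (𝓝 (∑ j ∈ Finset.range (n + 1), (n.choose j : ℝ) * if j = 0 then 1 else 0)) :=
    tendsto_finsetSum _ fun j hj => (tendsto_weightedTail_div hs hμ h
      (Nat.lt_succ_iff.1 (Finset.mem_range.1 hj))).const_mul _
  have hsum : ∑ j ∈ Finset.range (n + 1), (n.choose j : ℝ) * (if j = 0 then 1 else 0) = 1 := by
    simp
  rw [hsum] at hlim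
  refine hlim.congr' ?_
  filter_upwards [hs.eventually_id_pos] with x hx
  rw [measureReal_Ioi_eq_sum_weightedTail n hx, Finset.sum_div]
  refine Finset.sum_congr rfl fun j hj => ?_
  rw [← pow_sub_mul_pow x (Nat.lt_succ_iff.1 (Finset.mem_range.1 hj))]
  field_simp

theorem gammaVarying_measureReal_Ioi_of_weightedTail (hs : IsSelfNeglecting a l)
    (hμ : ∀ᶠ x in l, 0 < μ (Ioi x)) (h : GammaVarying (weightedTail μ n n) a l) :
    GammaVarying (fun x => μ.real (Ioi x)) a l := by
  refine (gammaVarying_weightedTail_of_le hs hμ h (Nat.zero_le n)).of_tendsto_div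
    (r := fun x => x ^ n) hs.tendsto_shift (fun t => ?_) one_ne_zero
    (tendsto_measureReal_Ioi_div_weightedTail hs hμ h)
  simpa only [div_pow, one_pow] using (hs.tendsto_shift_id_div_id t).pow n

end Tauberian

theorem coe_lt_rightEndpoint_iff {G : ℝ → ℝ} (hmono : Monotone G) {x : ℝ}
    (hright : ContinuousWithinAt G (Ioi x) x) : (x : EReal) < rightEndpoint G ↔ G x < 1 := by
  refine lt_sSup_iff.trans ⟨?_, fun hx => ?_⟩
  · rintro ⟨_, ⟨y, hy, rfl⟩, hxy⟩
    exact (hmono (EReal.coe_lt_coe_iff.1 hxy).le).trans_lt hy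
  · obtain ⟨y, hy, hxy⟩ := ((hright.eventually (gt_mem_nhds hx)).and self_mem_nhdsWithin).exists
    exact ⟨y, ⟨y, hy, rfl⟩, EReal.coe_lt_coe_iff.2 hxy⟩

theorem IsSurvivalFunction.rightEndpoint_eq {G : ℝ → ℝ} {e : EReal}
    (hg : IsSurvivalFunction (fun x => 1 - G x) e) : rightEndpoint G = e := by
  have hlt (x : ℝ) : G x < 1 ↔ (x : EReal) < e := sub_pos.symm.trans hg.pos_iff
  refine le_antisymm (sSup_le ?_) (le_of_forall_lt fun y hy => ?_)
  · rintro _ ⟨x, hx, rfl⟩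
    exact ((hlt x).1 hx).le
  · obtain ⟨x, hyx, hxe⟩ := EReal.lt_iff_exists_real_btwn.1 hy
    exact hyx.trans_le (le_sSup ⟨x, (hlt x).2 hxe, rfl⟩)

theorem IsSurvivalFunction.isAuxiliaryFunction_meanExcess {G H a : ℝ → ℝ} {e : EReal}
    (hG : IsSurvivalFunction (fun x => 1 - G x) e) (hH : IsSurvivalFunction (fun x => 1 - H x) e)
    (he : 0 < e) (hGa : GammaVarying (fun x => 1 - G x) a (upTo e))
    (hHa : GammaVarying (fun x => 1 - H x) a (upTo e)) :
    IsAuxiliaryFunction H (meanExcess e G) := by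
  have hequiv := hG.tendsto_meanExcess_div_aux hGa
  have hdiv := hequiv.mul (hG.tendsto_aux_div he hGa)
  rw [mul_zero] at hdiv
  unfold IsAuxiliaryFunction
  rw [hH.rightEndpoint_eq]
  exact ⟨fun x => hG.meanExcess_pos hGa,
    hdiv.congr fun x => div_mul_div_cancel₀ (hGa.aux_pos x).ne',
    hH.tendsto_div_of_aux_equivalent hHa hequiv⟩

section Williamson

variable {F : StieltjesFunction ℝ} {n : ℕ} {x : ℝ}

theorem measureReal_Ioi_eq_one_sub (htop : Tendsto F atTop (𝓝 1)) (x : ℝ) :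
    F.measure.real (Ioi x) = 1 - F x := by
  rw [Measure.real, F.measure_Ioi htop,
    ENNReal.toReal_ofReal (sub_nonneg.2 (F.mono.ge_of_tendsto htop x))]

theorem measure_Ioi_pos_iff (htop : Tendsto F atTop (𝓝 1)) :
    0 < F.measure (Ioi x) ↔ 0 < 1 - F x := by
  rw [F.measure_Ioi htop, ENNReal.ofReal_pos]

theorem continuousWithinAt_Ioi_stieltjes (F : StieltjesFunction ℝ) (x : ℝ) :
    ContinuousWithinAt F (Ioi x) x :=
  (F.right_continuous x).mono Ioi_subset_Ici_self

theorem isSurvivalFunction_one_sub (hbot : Tendsto F atBot (𝓝 0)) (htop : Tendsto F atTop (𝓝 1)) :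
    IsSurvivalFunction (fun x => 1 - F x) (rightEndpoint F) where
  antitone := fun _ _ hxy => sub_le_sub_left (F.mono hxy) 1
  nonneg := fun x => sub_nonneg.2 (F.mono.ge_of_tendsto htop x)
  tendsto_atBot := by simpa using hbot.const_sub 1
  pos_iff := sub_pos.trans
    (coe_lt_rightEndpoint_iff F.mono (continuousWithinAt_Ioi_stieltjes F _)).symm

theorem rightEndpoint_pos (hbot : Tendsto F atBot (𝓝 0)) (htop : Tendsto F atTop (𝓝 1))
    (h0 : F 0 = 0) : 0 < rightEndpoint F :=
  (isSurvivalFunction_one_sub hbot htop).pos_iff.1 (by simp [h0])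

theorem williamson_eq_weightedTail (hx : 0 < x) :
    williamson (n + 1) F x = weightedTail F.measure n n x := by
  rw [weightedTail_self hx, williamson, Nat.add_sub_cancel]

theorem one_sub_williamsonDF_of_pos (hx : 0 < x) :
    1 - williamsonDF (n + 1) F x = weightedTail F.measure n n x := by
  rw [williamsonDF, if_neg hx.le.not_gt, sub_sub_cancel, williamson_eq_weightedTail hx]

theorem one_sub_williamsonDF_of_nonpos {d : ℕ} (htop : Tendsto F atTop (𝓝 1)) (h0 : F 0 = 0)
    (hx : x ≤ 0) : 1 - williamsonDF d F x = 1 := by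
  rcases hx.lt_or_eq with hneg | rfl
  · rw [williamsonDF, if_pos hneg, sub_zero]
  · simp [williamsonDF, williamson, measureReal_Ioi_eq_one_sub htop, h0]

theorem isSurvivalFunction_one_sub_williamsonDF (hbot : Tendsto F atBot (𝓝 0))
    (htop : Tendsto F atTop (𝓝 1)) (h0 : F 0 = 0) :
    IsSurvivalFunction (fun x => 1 - williamsonDF (n + 1) F x) (rightEndpoint F) := by
  have := F.isProbabilityMeasure hbot htop
  have hpos {x : ℝ} : 0 < 1 - williamsonDF (n + 1) F x ↔ (x : EReal) < rightEndpoint F := by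
    rcases le_or_gt x 0 with hx | hx
    · rw [one_sub_williamsonDF_of_nonpos htop h0 hx]
      exact iff_of_true one_pos
        ((EReal.coe_nonpos.2 hx).trans_lt (rightEndpoint_pos hbot htop h0))
    · rw [one_sub_williamsonDF_of_pos hx, ← (isSurvivalFunction_one_sub hbot htop).pos_iff]
      exact ⟨fun h => measureReal_Ioi_eq_one_sub htop x ▸ h.trans_le (weightedTail_self_le hx),
        fun h => weightedTail_pos le_rfl hx ((measure_Ioi_pos_iff htop).2 h)⟩
  refine ⟨fun x y hxy => ?_, fun x => ?_, ?_, hpos⟩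
  · rcases le_or_gt x 0 with hx | hx
    · simp only [one_sub_williamsonDF_of_nonpos htop h0 hx]
      rcases le_or_gt y 0 with hy | hy
      · exact (one_sub_williamsonDF_of_nonpos htop h0 hy).le
      · exact one_sub_williamsonDF_of_pos hy ▸ (weightedTail_self_le hy).trans measureReal_le_one
    · simp only [one_sub_williamsonDF_of_pos hx, one_sub_williamsonDF_of_pos (hx.trans_le hxy)]
      exact antitoneOn_weightedTail le_rfl hx (hx.trans_le hxy) hxy
  · rcases le_or_gt x 0 with hx | hx
    · simp only [one_sub_williamsonDF_of_nonpos htop h0 hx, zero_le_one]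
    · exact one_sub_williamsonDF_of_pos hx ▸ weightedTail_nonneg hx
  · refine tendsto_const_nhds.congr' ?_
    filter_upwards [eventually_le_atBot 0] with x hx
    exact (one_sub_williamsonDF_of_nonpos htop h0 hx).symm

theorem gammaVarying_one_sub_iff_williamsonDF {a : ℝ → ℝ} (hbot : Tendsto F atBot (𝓝 0))
    (htop : Tendsto F atTop (𝓝 1)) (h0 : F 0 = 0) :
    GammaVarying (fun x => 1 - F x) a (upTo (rightEndpoint F)) ↔
      GammaVarying (fun x => 1 - williamsonDF (n + 2) F x) a (upTo (rightEndpoint F)) := by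
  have := F.isProbabilityMeasure hbot htop
  have he := rightEndpoint_pos hbot htop h0
  have hF := isSurvivalFunction_one_sub hbot htop
  have hψ := isSurvivalFunction_one_sub_williamsonDF (n := n + 1) hbot htop h0
  have htail : (fun x => F.measure.real (Ioi x)) = fun x => 1 - F x :=
    funext (measureReal_Ioi_eq_one_sub htop)
  have heq : weightedTail F.measure (n + 1) (n + 1) =ᶠ[upTo (rightEndpoint F)]
      fun x => 1 - williamsonDF (n + 2) F x := by
    filter_upwards [eventually_upTo_gt he] with x hx
    exact (one_sub_williamsonDF_of_pos hx).symm
  constructor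
  · intro h
    have hs := hF.isSelfNeglecting he h
    rw [← htail] at hF h
    exact (gammaVarying_weightedTail_of_measureReal_Ioi n hF he h).congr' hs.tendsto_shift heq
  · intro h
    have hs := hψ.isSelfNeglecting he h
    rw [← htail]
    exact gammaVarying_measureReal_Ioi_of_weightedTail hs
      (hF.eventually_pos.mono fun x => (measure_Ioi_pos_iff htop).2)
      (h.congr' hs.tendsto_shift heq.symm)

section Derivatives

variable [IsFiniteMeasure F.measure]

theorem isDecrementDensity_weightedTail_zero :
    IsDecrementDensity (fun t => t⁻¹ ^ n) F (weightedTail F.measure n 0) (Ioi 0) := by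
  intro x hx y _ hxy
  have hmass : F.measure.real (Ioc x y) = F y - F x := by
    rw [Measure.real, F.measure_Ioc, ENNReal.toReal_ofReal (sub_nonneg.2 (F.mono hxy))]
  exact hmass ▸ weightedTail_zero_sub_bounds hx hxy

theorem iteratedDeriv_williamson {k : ℕ} (hk : k < n) (hx : 0 < x) :
    iteratedDeriv k (williamson (n + 1) F) x =
      (-1) ^ k * n.descFactorial k * weightedTail F.measure n (n - k) x := by
  induction k generalizing x with
  | zero => simpa using williamson_eq_weightedTail hx
  | succ k ih =>
    have heq : iteratedDeriv k (williamson (n + 1) F) =ᶠ[𝓝 x] fun x =>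
        (-1) ^ k * n.descFactorial k * weightedTail F.measure n (n - k) x := by
      exact (lt_mem_nhds hx).mono fun _ => ih (by omega)
    obtain ⟨i, rfl⟩ : ∃ i, n = k + 1 + (i + 1) := ⟨n - k - 2, by omega⟩
    have hcont : ContinuousAt (weightedTail F.measure (k + 1 + (i + 1)) (i + 1)) x :=
      (isDecrementDensity_weightedTail (by omega)).continuousAt (Ioi_mem_nhds hx)
    have hderiv := (isDecrementDensity_weightedTail (μ := F.measure) (n := k + 1 + (i + 1))
      (j := i + 1) (by omega)).hasDerivAt (Ioi_mem_nhds hx) (hcont.const_mul _)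
    rw [iteratedDeriv_succ, heq.deriv_eq, Nat.descFactorial_succ,
      show k + 1 + (i + 1) - k = i + 1 + 1 by omega, Nat.add_sub_cancel_left,
      (hderiv.const_mul _).deriv, pow_succ]
    push_cast
    ring

theorem continuousWithinAt_Ioi_weightedTail_zero (hx : 0 < x) :
    ContinuousWithinAt (weightedTail F.measure n 0) (Ioi x) x :=
  isDecrementDensity_weightedTail_zero.continuousWithinAt hx
    (mem_nhdsWithin_of_mem_nhds (Ioi_mem_nhds hx))
    (((continuousAt_inv₀ hx.ne').pow n).abs.continuousWithinAt.isBoundedUnder_le)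
    (continuousWithinAt_Ioi_stieltjes F x)

theorem williamsonTopDeriv_eq_weightedTail (hx : 0 < x) :
    williamsonTopDeriv (n + 2) F x =
      (-1) ^ (n + 1) * (n + 1).factorial * weightedTail F.measure (n + 1) 0 x := by
  have hiter (y : ℝ) (hy : 0 < y) : iteratedDeriv n (williamson (n + 2) F) y =
      (-1) ^ n * (n + 1).descFactorial n * weightedTail F.measure (n + 1) (0 + 1) y := by
    rw [iteratedDeriv_williamson n.lt_add_one hy, Nat.add_sub_cancel_left, zero_add]
  have hderiv := (isDecrementDensity_weightedTail (μ := F.measure) (n := n + 1) (j := 0)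
    (by omega)).hasDerivWithinAt hx (mem_nhdsWithin_of_mem_nhds (Ioi_mem_nhds hx))
    ((continuousWithinAt_Ioi_weightedTail_zero hx).const_mul _) (hasDerivWithinAt_id x (Ioi x))
  have hfactorial : (n + 1).descFactorial n = (n + 1).factorial := by
    simpa using Nat.factorial_mul_descFactorial n.le_succ
  rw [williamsonTopDeriv, Nat.add_sub_cancel,
    derivWithin_congr (s := Ioi x) (fun y hy => hiter y (hx.trans hy)) (hiter x hx),
    (hderiv.const_mul _).derivWithin (uniqueDiffWithinAt_Ioi x), hfactorial]
  push_cast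
  ring

theorem differentiableOn_iff_weightedTail_zero :
    DifferentiableOn ℝ F (Ioi 0) ↔ DifferentiableOn ℝ (weightedTail F.measure n 0) (Ioi 0) :=
  forall₂_congr fun _ hx => (isDecrementDensity_weightedTail_zero.differentiableWithinAt_iff hx
    self_mem_nhdsWithin ((continuousAt_inv₀ (ne_of_gt hx)).pow n).continuousWithinAt
    (pow_ne_zero n (inv_ne_zero (ne_of_gt hx)))).symm

theorem differentiableOn_iff_williamsonTopDeriv :
    DifferentiableOn ℝ F (Ioi 0) ↔ DifferentiableOn ℝ (williamsonTopDeriv (n + 2) F) (Ioi 0) := by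
  have hconst : ((-1 : ℝ) ^ (n + 1) * (n + 1).factorial) ≠ 0 :=
    mul_ne_zero (pow_ne_zero _ (by norm_num)) (Nat.cast_ne_zero.2 (n + 1).factorial_ne_zero)
  rw [differentiableOn_iff_weightedTail_zero (n := n + 1),
    differentiableOn_congr (s := Ioi 0) fun x hx => williamsonTopDeriv_eq_weightedTail hx]
  exact ⟨fun h => h.const_mul _, fun h =>
    (h.const_mul ((-1 : ℝ) ^ (n + 1) * (n + 1).factorial)⁻¹).congr fun x _ =>
      (inv_mul_cancel_left₀ hconst _).symm⟩

end Derivatives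

end Williamson

theorem mainTheorem2_general (d : ℕ) (hd : 2 ≤ d) (F : StieltjesFunction ℝ)
    (hbot : Tendsto F atBot (𝓝 0)) (htop : Tendsto F atTop (𝓝 1)) (h0 : F 0 = 0) :
    (DifferentiableOn ℝ F (Ioi 0) ↔ DifferentiableOn ℝ (williamsonTopDeriv d F) (Ioi 0)) ∧
    (InMDA F gumbel ↔ InMDA (williamsonDF d F) gumbel) ∧
    (InMDA F gumbel →
      IsAuxiliaryFunction F (meanExcess (rightEndpoint F) F) ∧
      IsAuxiliaryFunction (williamsonDF d F) (meanExcess (rightEndpoint F) F) ∧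
      IsAuxiliaryFunction F (meanExcess (rightEndpoint F) (williamsonDF d F)) ∧
      IsAuxiliaryFunction (williamsonDF d F)
        (meanExcess (rightEndpoint F) (williamsonDF d F))) := by
  obtain ⟨n, rfl⟩ := Nat.exists_eq_add_of_le' hd
  have := F.isProbabilityMeasure hbot htop
  have he := rightEndpoint_pos hbot htop h0
  have hF := isSurvivalFunction_one_sub hbot htop
  have hψ := isSurvivalFunction_one_sub_williamsonDF (n := n + 1) hbot htop h0
  rw [hF.inMDA_gumbel_iff, hψ.inMDA_gumbel_iff]
  refine ⟨differentiableOn_iff_williamsonTopDeriv,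
    exists_congr fun _ => gammaVarying_one_sub_iff_williamsonDF hbot htop h0, ?_⟩
  rintro ⟨a, ha⟩
  have hψa := (gammaVarying_one_sub_iff_williamsonDF (n := n) hbot htop h0).1 ha
  exact ⟨hF.isAuxiliaryFunction_meanExcess hF he ha ha,
    hF.isAuxiliaryFunction_meanExcess hψ he ha hψa, hψ.isAuxiliaryFunction_meanExcess hF he hψa ha,
    hψ.isAuxiliaryFunction_meanExcess hψ he hψa hψa⟩

theorem mainTheorem2 (d : ℕ) (hd : 2 ≤ d) (F : StieltjesFunction ℝ)
    (hbot : Tendsto F atBot (𝓝 0)) (htop : Tendsto F atTop (𝓝 1)) (h0 : F 0 = 0)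
    (hdiff : DifferentiableOn ℝ F (Ioi 0) ∨ DifferentiableOn ℝ (williamsonTopDeriv d F) (Ioi 0)) :
    (DifferentiableOn ℝ F (Ioi 0) ∧ DifferentiableOn ℝ (williamsonTopDeriv d F) (Ioi 0)) ∧
    (MonotoneNearLeft (deriv F) (rightEndpoint F) →
      (InMDA F gumbel ↔ InMDA (williamsonDF d F) gumbel) ∧
      (InMDA F gumbel →
        IsAuxiliaryFunction F (meanExcess (rightEndpoint F) F) ∧
        IsAuxiliaryFunction (williamsonDF d F) (meanExcess (rightEndpoint F) F) ∧
        IsAuxiliaryFunction F (meanExcess (rightEndpoint F) (williamsonDF d F)) ∧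
        IsAuxiliaryFunction (williamsonDF d F)
          (meanExcess (rightEndpoint F) (williamsonDF d F)))) := by
  obtain ⟨hiff, hMDA⟩ := mainTheorem2_general d hd F hbot htop h0
  exact ⟨⟨hdiff.elim id hiff.2, hdiff.elim hiff.1 id⟩, fun _ => hMDA⟩
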